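/- Let $S^1=\mathbb R/\mathbb Z$, let $\Gamma$ be a subgroup of the group $\mathrm{Diff}^1_+(S^1)$ of orientation-preserving $C^1$ diffeomorphisms of $S^1$, and let $\mu$ be a probability measure on $\Gamma$ with finite support which is symmetric ($\mu(g^{-1})=\mu(g)$ for all $g\in\Gamma$) and non-degenerate (the support of $\mu$ generates $\Gamma$ as a semigroup). Suppose that no Borel probability measure on $S^1$ is invariant under every element of $\Gamma$. Then there is exactly one $\mu$-stationary Borel probability measure $\nu$ on $S^1$, i.e. exactly one $\nu$ such that $$\int_{S^1}\psi\,d\nu=\int_\Gamma\int_{S^1}\psi(g(x))\,d\nu(x)\,d\mu(g)\quad\text{for every continuous }\psi:S^1\to\mathbb R,$$ and its Lyapunov exponent is strictly negative: writing $h_n(\omega)=g_n\circ\cdots\circ g_1$ for $\omega=(g_1,g_2,\dots)\in\Gamma^{\mathbb N}$, for $\mu^{\mathbb N}\times\nu$-almost every $(\omega,x)$ one has $$\lim_{n\to\infty}\frac{\log\big(h_n(\omega)'(x)\big)}{n}=\lambda(\nu)=\int_\Gamma\int_{S^1}\log\big(g'(x)\big)\,d\nu(x)\,d\mu(g)<0.$$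 -/

import Mathlib

open MeasureTheory Filter Topology

noncomputable section

/-- The group `Homeo(S¹)` of homeomorphisms of the circle `S¹ = ℝ/ℤ`
(the product of two homeomorphisms is their composition). -/
abbrev CircleHomeo : Type := UnitAddCircle ≃ₜ UnitAddCircle

/-- `F : ℝ → ℝ` is a lift of `f : S¹ → S¹` to the universal cover `ℝ`
which is of class `C¹` with everywhere positive derivative. -/
structure IsC1Lift (F : ℝ → ℝ) (f : UnitAddCircle → UnitAddCircle) : Prop where
  contDiff : ContDiff ℝ 1 F
  deriv_pos : ∀ t : ℝ, 0 < deriv F t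
  lifts : ∀ t : ℝ, f (t : UnitAddCircle) = ((F t : ℝ) : UnitAddCircle)

theorem IsC1Lift.id : IsC1Lift (fun t => t) (fun x => x) :=
  ⟨contDiff_id, fun t => by simp, fun _ => rfl⟩

theorem IsC1Lift.comp {F G : ℝ → ℝ} {f g : UnitAddCircle → UnitAddCircle}
    (hF : IsC1Lift F f) (hG : IsC1Lift G g) :
    IsC1Lift (fun t => F (G t)) (fun x => f (g x)) := by
  refine ⟨hF.contDiff.comp hG.contDiff, fun t => ?_, fun t => ?_⟩
  · have h1 := (hF.contDiff.differentiable one_ne_zero (G t)).hasDerivAt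
    have h2 := (hG.contDiff.differentiable one_ne_zero t).hasDerivAt
    have h3 : HasDerivAt (fun t => F (G t)) (deriv F (G t) * deriv G t) t := h1.comp t h2
    rw [h3.deriv]
    exact mul_pos (hF.deriv_pos _) (hG.deriv_pos _)
  · simp only [hG.lifts, hF.lifts]

theorem IsC1Lift.strictMono {F : ℝ → ℝ} {f : UnitAddCircle → UnitAddCircle}
    (hF : IsC1Lift F f) : StrictMono F :=
  strictMono_of_deriv_pos hF.deriv_pos

theorem IsC1Lift.exists_int {F : ℝ → ℝ} {f : UnitAddCircle → UnitAddCircle}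
    (hF : IsC1Lift F f) : ∃ k : ℤ, 1 ≤ k ∧ ∀ t, F (t + 1) = F t + k := by
  have hint : ∀ t, ∃ n : ℤ, F (t + 1) - F t = n := by
    intro t
    have h : ((F (t + 1) - F t : ℝ) : UnitAddCircle) = 0 := by
      rw [AddCircle.coe_sub, ← hF.lifts, ← hF.lifts, AddCircle.coe_add_period, sub_self]
    obtain ⟨n, hn⟩ := AddCircle.coe_eq_zero_iff (p := (1 : ℝ)) |>.1 h
    exact ⟨n, by simpa using hn.symm⟩
  choose n hn using hint
  have hcF := hF.contDiff.continuous
  have hcont : Continuous (fun t => F (t + 1) - F t) := by fun_prop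
  have hn' : Continuous n := by
    rw [Int.isClosedEmbedding_coe_real.isEmbedding.continuous_iff]
    have : ((fun m : ℤ => (m : ℝ)) ∘ n) = fun t => F (t + 1) - F t := by
      funext t; simp [hn]
    rw [this]; exact hcont
  have hconst : ∀ t, n t = n 0 := fun t =>
    PreconnectedSpace.constant inferInstance hn'
  refine ⟨n 0, ?_, fun t => ?_⟩
  · have h1 : (0 : ℝ) < n 0 := by
      rw [← hn]; have := hF.strictMono (show (0 : ℝ) < 0 + 1 by norm_num); linarith
    exact_mod_cast h1
  · have := hn t; rw [hconst t] at this; linarith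

theorem IsC1Lift.surjective {F : ℝ → ℝ} {f : UnitAddCircle → UnitAddCircle}
    (hF : IsC1Lift F f) : Function.Surjective F := by
  obtain ⟨k, hk, hadd⟩ := hF.exists_int
  have hk' : (1 : ℝ) ≤ k := by exact_mod_cast hk
  have hup : ∀ m : ℕ, F m = F 0 + m * k := by
    intro m
    induction m with
    | zero => simp
    | succ m ih => push_cast; rw [hadd, ih]; ring
  have hdown : ∀ m : ℕ, F (-m) = F 0 - m * k := by
    intro m
    induction m with
    | zero => simp
    | succ m ih =>
      have h := hadd (-((m : ℝ) + 1))
      rw [show -((m : ℝ) + 1) + 1 = -m by ring, ih] at h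
      push_cast; linarith
  refine hF.contDiff.continuous.surjective ?_ ?_
  · refine tendsto_atTop_atTop.2 fun b => ?_
    obtain ⟨m, hm⟩ := exists_nat_ge (b - F 0)
    refine ⟨m, fun a ha => ?_⟩
    have h1 := hF.strictMono.monotone ha
    rw [hup] at h1
    nlinarith [Nat.cast_nonneg (α := ℝ) m]
  · refine tendsto_atBot_atBot.2 fun b => ?_
    obtain ⟨m, hm⟩ := exists_nat_ge (F 0 - b)
    refine ⟨-m, fun a ha => ?_⟩
    have h1 := hF.strictMono.monotone ha
    rw [hdown] at h1
    nlinarith [Nat.cast_nonneg (α := ℝ) m]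

theorem IsC1Lift.exists_symm {F : ℝ → ℝ} {f : CircleHomeo} (hF : IsC1Lift F f) :
    ∃ G : ℝ → ℝ, IsC1Lift G f.symm := by
  let e : ℝ ≃ₜ ℝ := (hF.strictMono.orderIsoOfSurjective F hF.surjective).toHomeomorph
  have he : ∀ t, e t = F t := fun _ => rfl
  have hd : ∀ t, HasDerivAt e (deriv F t) t := fun t =>
    (hF.contDiff.differentiable one_ne_zero t).hasDerivAt
  have hne : ∀ t, deriv F t ≠ 0 := fun t => (hF.deriv_pos t).ne'
  refine ⟨e.symm, e.contDiff_symm_deriv hne hd hF.contDiff, fun t => ?_, fun t => ?_⟩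
  · have h : HasDerivAt e.symm (deriv F (e.symm t))⁻¹ t :=
      HasDerivAt.of_local_left_inverse e.symm.continuous.continuousAt (hd _) (hne _)
        (Eventually.of_forall fun y => e.apply_symm_apply y)
    rw [h.deriv]
    exact inv_pos.2 (hF.deriv_pos _)
  · have h := hF.lifts (e.symm t)
    rw [← he, e.apply_symm_apply] at h
    rw [← h, f.symm_apply_apply]

/-- `Diff¹₊(S¹)`: the group of orientation preserving `C¹` diffeomorphisms of the circle, i.e. of
the homeomorphisms which lift to a `C¹` map `ℝ → ℝ` with everywhere positive derivative. -/
def circleDiffOne : Subgroup CircleHomeo where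
  carrier := {f | ∃ F : ℝ → ℝ, IsC1Lift F f}
  mul_mem' := by
    rintro f g ⟨F, hF⟩ ⟨G, hG⟩
    exact ⟨_, hF.comp hG⟩
  one_mem' := ⟨_, IsC1Lift.id⟩
  inv_mem' := by
    rintro f ⟨F, hF⟩
    exact hF.exists_symm

/-- The derivative `f'(x)` of a map `f : S¹ → S¹` with respect to the coordinate of `ℝ/ℤ`: the
derivative at `t = 0` of `t ↦ f (x + t) - f x`, the latter being read in `(-1/2, 1/2]`. -/
def circleDeriv (f : UnitAddCircle → UnitAddCircle) (x : UnitAddCircle) : ℝ :=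
  deriv (fun t : ℝ =>
    ((AddCircle.equivIoc (1 : ℝ) (-1 / 2) (f (x + (t : UnitAddCircle)) - f x) :
      Set.Ioc (-1 / 2 : ℝ) (-1 / 2 + 1)) : ℝ)) 0

/-- The derivative on the circle is the derivative of any lift. -/
theorem IsC1Lift.circleDeriv_eq {F : ℝ → ℝ} {f : UnitAddCircle → UnitAddCircle}
    (hF : IsC1Lift F f) (s : ℝ) : circleDeriv f (s : UnitAddCircle) = deriv F s := by
  have hcF := hF.contDiff.continuous
  have hc : Continuous fun t : ℝ => F (s + t) - F s := by fun_prop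
  have hmem : ∀ᶠ t : ℝ in 𝓝 0, F (s + t) - F s ∈ Set.Ioc (-1 / 2 : ℝ) (-1 / 2 + 1) := by
    refine hc.continuousAt.eventually (Ioc_mem_nhds ?_ ?_) <;> norm_num
  have heq : (fun t : ℝ =>
      ((AddCircle.equivIoc (1 : ℝ) (-1 / 2)
        (f ((s : UnitAddCircle) + (t : UnitAddCircle)) - f (s : UnitAddCircle)) :
        Set.Ioc (-1 / 2 : ℝ) (-1 / 2 + 1)) : ℝ)) =ᶠ[𝓝 0] fun t => F (s + t) - F s := by
    filter_upwards [hmem] with t ht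
    rw [← AddCircle.coe_add, hF.lifts, hF.lifts, ← AddCircle.coe_sub,
      AddCircle.equivIoc_coe_eq ht]
  rw [circleDeriv, heq.deriv_eq, deriv_sub_const, deriv_comp_const_add, add_zero]

/-- A (countable) group `Γ` of homeomorphisms of the circle carries the discrete σ-algebra. -/
instance instMeasurableSpaceCircleSubgroup (Γ : Subgroup CircleHomeo) : MeasurableSpace Γ := ⊤

/-- `Γ` preserves the measure `ν`. -/
def PreservesMeasure (Γ : Subgroup CircleHomeo) (ν : Measure UnitAddCircle) : Prop :=
  ∀ g ∈ Γ, ν.map g = ν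

/-- `μ` is symmetric: `μ(g⁻¹) = μ(g)`. -/
def IsSymmetricLaw {Γ : Subgroup CircleHomeo} (μ : PMF Γ) : Prop := ∀ g : Γ, μ g⁻¹ = μ g

/-- `μ` is non-degenerate: its support generates `Γ` as a semigroup. -/
def IsNondegenerateLaw {Γ : Subgroup CircleHomeo} (μ : PMF Γ) : Prop := Subsemigroup.closure μ.support = ⊤

/-- The measure `ν` is `μ`-stationary: `∫ ψ dν = ∫_Γ ∫_{S¹} ψ(g x) dν(x) dμ(g)` for every
continuous function `ψ` on the circle. -/
def IsStationaryMeasure {Γ : Subgroup CircleHomeo} (μ : PMF Γ)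
    (ν : Measure UnitAddCircle) : Prop :=
  ∀ ψ : C(UnitAddCircle, ℝ),
    ∫ x, ψ x ∂ν = ∫ g : Γ, (∫ x, ψ ((g : CircleHomeo) x) ∂ν) ∂μ.toMeasure

/-- The random compositions `h_n(ω) = g_n ⋯ g_1`, where `ω = (g_1, g_2, …) ∈ Γ^ℕ`
is indexed by `g_{i+1} = ω i`. -/
def randomComp {Γ : Subgroup CircleHomeo} (ω : ℕ → Γ) : ℕ → Γ
  | 0 => 1
  | n + 1 => ω n * randomComp ω n

/-- `Λ` is the almost sure Lyapunov exponent of the stationary measure `ν`: for `ℙ × ν`-almost every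
`(ω, x)`, where `ℙ = μ^ℕ`, one has `log (h_n(ω)'(x)) / n → Λ`. -/
def HasLyapunovExponent {Γ : Subgroup CircleHomeo} (μ : PMF Γ)
    (ν : Measure UnitAddCircle) (Λ : ℝ) : Prop :=
  ∀ᵐ p ∂((Measure.infinitePi fun _ : ℕ => μ.toMeasure).prod ν),
    Tendsto
      (fun n : ℕ => Real.log (circleDeriv (randomComp p.1 n : CircleHomeo) p.2) / (n : ℝ))
      atTop (𝓝 Λ)

/-- The mean Lyapunov exponent `λ(ν) = ∫_Γ ∫_{S¹} log g'(x) dν(x) dμ(g)`. -/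
def lyapunovExponent {Γ : Subgroup CircleHomeo} (μ : PMF Γ)
    (ν : Measure UnitAddCircle) : ℝ :=
  ∫ g : Γ, (∫ x, Real.log (circleDeriv (g : CircleHomeo) x) ∂ν) ∂μ.toMeasure

end

/-! Write P for the averaging operator `markovOp` of the walk. Uniqueness, negativity and almost
sure convergence have three separate causes.

Uniqueness comes from symmetry and a maximum principle. A stationary measure has no atoms, because
its heaviest atoms would form a finite invariant set, which carries an invariant measure
(`measureReal_singleton_eq_zero`). Its distribution function, lifted to the line, is therefore
continuous. Since μ is symmetric, stationarity says that this function is P-harmonic up to an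
additive constant (`liftCdf_sub_eq_sum`). The difference of two such functions descends to the
circle. The constant must vanish, and the sets of maxima and of minima are closed and invariant. If
they were disjoint, the points of one set that immediately precede the other would form a finite
invariant set (`exists_finite_invariant_of_disjoint`). So the difference is constant
(`eq_const_of_markovOp_eq`) and the measures agree.

Negativity comes from the entropy ∫ ρ log ρ of densities evolving from Lebesgue measure. Pushing ρ
by g changes it by -∫ ρ log g', and averaging the images over g loses their relative entropies with
respect to the average. The entropy starts at 0 and is never negative, so the Cesàro means of the
mean log-derivative plus the relative entropies are at most 0. Relative entropy is not weakly
continuous; its variational lower bound by a continuous test function is, and it survives in the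
limit stationary measure (`exists_stationary_entropy_le`). If the exponent were nonnegative, these
bounds would force every generator to preserve the limit (`map_eq_of_forall_exp`).

Convergence follows from uniqueness. Cesàro averages under P converge uniformly
(`exists_cesaroOp_near`), so the mean log-derivative is nearly constant modulo a coboundary. What
remains of the log-derivative cocycle is a bounded orthogonal sequence, and second moments suffice
for it (`ae_tendsto_average_zero`); no ergodic theorem enters. -/

/-! ### Finitely supported Markov operators on a compact space -/

section MarkovOp

variable {X : Type*} [TopologicalSpace X] [CompactSpace X] {ι : Type*}

/-- The Markov operator `ψ ↦ ∑ i, w i • ψ ∘ h i` on continuous functions. -/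
noncomputable def markovOp (s : Finset ι) (w : ι → ℝ) (h : ι → C(X, X)) :
    C(X, ℝ) →ₗ[ℝ] C(X, ℝ) where
  toFun ψ := ∑ i ∈ s, w i • ψ.comp (h i)
  map_add' ψ φ := by
    ext x; simp [ContinuousMap.sum_apply, Finset.sum_add_distrib]
  map_smul' c ψ := by
    ext x
    simp only [ContinuousMap.sum_apply, ContinuousMap.smul_apply, ContinuousMap.comp_apply,
      smul_eq_mul, Finset.mul_sum, RingHom.id_apply]
    exact Finset.sum_congr rfl fun i _ => by ring

/-- The Cesàro averages of the iterates of a linear operator. -/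
noncomputable def cesaroOp (P : C(X, ℝ) →ₗ[ℝ] C(X, ℝ)) (N : ℕ) : C(X, ℝ) →ₗ[ℝ] C(X, ℝ) :=
  (N : ℝ)⁻¹ • ∑ k ∈ Finset.range N, P ^ k

variable {s : Finset ι} {w : ι → ℝ} {h : ι → C(X, X)}

theorem markovOp_apply (ψ : C(X, ℝ)) (x : X) :
    markovOp s w h ψ x = ∑ i ∈ s, w i * ψ (h i x) := by
  simp [markovOp, ContinuousMap.sum_apply]

theorem cesaroOp_apply (P : C(X, ℝ) →ₗ[ℝ] C(X, ℝ)) (N : ℕ) (ψ : C(X, ℝ)) :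
    cesaroOp P N ψ = (N : ℝ)⁻¹ • ∑ k ∈ Finset.range N, (P ^ k) ψ := by
  simp [cesaroOp, LinearMap.sum_apply]

theorem norm_markovOp_le (hw : ∀ i ∈ s, 0 ≤ w i) (hsum : ∑ i ∈ s, w i = 1) (ψ : C(X, ℝ)) :
    ‖markovOp s w h ψ‖ ≤ ‖ψ‖ := by
  rw [ContinuousMap.norm_le _ (norm_nonneg _)]
  intro x
  rw [markovOp_apply]
  calc ‖∑ i ∈ s, w i * ψ (h i x)‖ ≤ ∑ i ∈ s, ‖w i * ψ (h i x)‖ := norm_sum_le _ _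
    _ ≤ ∑ i ∈ s, w i * ‖ψ‖ := Finset.sum_le_sum fun i hi => by
        rw [norm_mul, Real.norm_of_nonneg (hw i hi)]
        exact mul_le_mul_of_nonneg_left (ψ.norm_coe_le_norm _) (hw i hi)
    _ = ‖ψ‖ := by rw [← Finset.sum_mul, hsum, one_mul]

theorem norm_markovOp_pow_le (hw : ∀ i ∈ s, 0 ≤ w i) (hsum : ∑ i ∈ s, w i = 1) (k : ℕ)
    (ψ : C(X, ℝ)) : ‖(markovOp s w h ^ k) ψ‖ ≤ ‖ψ‖ := by
  induction k with
  | zero => simp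
  | succ k ih =>
    rw [pow_succ', Module.End.mul_apply]
    exact (norm_markovOp_le hw hsum _).trans ih

theorem cesaroOp_comp_sub (P : C(X, ℝ) →ₗ[ℝ] C(X, ℝ)) (N : ℕ) (ψ : C(X, ℝ)) :
    cesaroOp P N (P ψ) - cesaroOp P N ψ = (N : ℝ)⁻¹ • ((P ^ N) ψ - ψ) := by
  rw [cesaroOp_apply, cesaroOp_apply, ← smul_sub, ← Finset.sum_sub_distrib]
  have := Finset.sum_range_sub (fun k => (P ^ k) ψ) N
  simp only [pow_succ, Module.End.mul_apply, pow_zero, Module.End.one_apply] at this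
  rw [this]

/-- `ψ` minus its Cesàro average is a coboundary. -/
theorem exists_sub_cesaroOp_eq (P : C(X, ℝ) →ₗ[ℝ] C(X, ℝ)) {N : ℕ} (hN : N ≠ 0) (ψ : C(X, ℝ)) :
    ∃ f : C(X, ℝ), ψ - cesaroOp P N ψ = f - P f := by
  -- Averages over k < N the identity (1 - P)(1 + P + ... + P^(k-1)) = 1 - P^k.
  refine ⟨(N : ℝ)⁻¹ • ∑ k ∈ Finset.range N, ∑ j ∈ Finset.range k, (P ^ j) ψ, ?_⟩
  have hN' : (N : ℝ) ≠ 0 := by exact_mod_cast hN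
  rw [map_smul, ← smul_sub, map_sum, ← Finset.sum_sub_distrib, cesaroOp_apply]
  have h1 : ∀ k, ∑ j ∈ Finset.range k, (P ^ j) ψ - P (∑ j ∈ Finset.range k, (P ^ j) ψ)
      = ψ - (P ^ k) ψ := by
    intro k
    have := Finset.sum_range_sub' (fun k => (P ^ k) ψ) k
    simp only [pow_succ', Module.End.mul_apply, pow_zero, Module.End.one_apply] at this
    rw [map_sum, ← Finset.sum_sub_distrib, this]
  simp only [h1, Finset.sum_sub_distrib, Finset.sum_const, Finset.card_range, smul_sub]
  rw [← Nat.cast_smul_eq_nsmul ℝ, smul_smul, inv_mul_cancel₀ hN', one_smul]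

variable [MeasurableSpace X] [BorelSpace X]

theorem ContinuousMap.integrable_of_isFiniteMeasure (ψ : C(X, ℝ)) (m : Measure X)
    [IsFiniteMeasure m] : Integrable ψ m :=
  ψ.continuous.integrable_of_hasCompactSupport (HasCompactSupport.of_compactSpace ψ)

theorem exists_measure_integral_eq_sum {κ : Type*} {t : Finset κ} {v : κ → ℝ}
    (hv : ∀ i ∈ t, 0 ≤ v i) (hsum : ∑ i ∈ t, v i = 1) (m : κ → Measure X)
    (hm : ∀ i, IsProbabilityMeasure (m i)) :
    ∃ m' : Measure X, IsProbabilityMeasure m' ∧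
      ∀ ψ : C(X, ℝ), ∫ x, ψ x ∂m' = ∑ i ∈ t, v i * ∫ x, ψ x ∂(m i) := by
  refine ⟨∑ i ∈ t, ENNReal.ofReal (v i) • m i, ⟨?_⟩, fun ψ => ?_⟩
  · simp only [Measure.coe_finsetSum, Finset.sum_apply, Measure.smul_apply, measure_univ,
      smul_eq_mul, mul_one]
    rw [← ENNReal.ofReal_sum_of_nonneg hv, hsum, ENNReal.ofReal_one]
  · rw [integral_finsetSum_measure]
    · refine Finset.sum_congr rfl fun i hi => ?_
      rw [integral_smul_measure, ENNReal.toReal_ofReal (hv i hi), smul_eq_mul]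
    · intro i _
      exact (ψ.integrable_of_isFiniteMeasure (m i)).smul_measure ENNReal.ofReal_ne_top

theorem integral_markovOp (m : Measure X) [IsFiniteMeasure m] (ψ : C(X, ℝ)) :
    ∫ x, markovOp s w h ψ x ∂m = ∑ i ∈ s, w i * ∫ x, ψ (h i x) ∂m := by
  simp only [markovOp_apply]
  rw [integral_finsetSum]
  · simp only [integral_const_mul]
  · intro i _
    exact ((ψ.comp (h i)).integrable_of_isFiniteMeasure m).const_mul _

theorem exists_measure_integral_eq_markovOp (hw : ∀ i ∈ s, 0 ≤ w i) (hsum : ∑ i ∈ s, w i = 1)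
    (m : Measure X) [IsProbabilityMeasure m] :
    ∃ m' : Measure X, IsProbabilityMeasure m' ∧
      ∀ ψ : C(X, ℝ), ∫ x, ψ x ∂m' = ∫ x, markovOp s w h ψ x ∂m := by
  obtain ⟨m', hm', H⟩ := exists_measure_integral_eq_sum hw hsum (fun i => m.map (h i))
    fun i => Measure.isProbabilityMeasure_map (h i).continuous.measurable.aemeasurable
  refine ⟨m', hm', fun ψ => ?_⟩
  rw [H, integral_markovOp]
  refine Finset.sum_congr rfl fun i _ => ?_
  rw [integral_map (h i).continuous.measurable.aemeasurable
    ψ.continuous.aestronglyMeasurable]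

theorem exists_measure_integral_eq_markovOp_pow (hw : ∀ i ∈ s, 0 ≤ w i)
    (hsum : ∑ i ∈ s, w i = 1) (m : Measure X) [IsProbabilityMeasure m] (k : ℕ) :
    ∃ m' : Measure X, IsProbabilityMeasure m' ∧
      ∀ ψ : C(X, ℝ), ∫ x, ψ x ∂m' = ∫ x, (markovOp s w h ^ k) ψ x ∂m := by
  induction k with
  | zero => exact ⟨m, inferInstance, fun ψ => by simp⟩
  | succ k ih =>
    obtain ⟨m₁, hm₁, H₁⟩ := ih
    obtain ⟨m₂, hm₂, H₂⟩ := exists_measure_integral_eq_markovOp (h := h) hw hsum m₁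
    refine ⟨m₂, hm₂, fun ψ => ?_⟩
    rw [H₂, H₁, pow_succ, Module.End.mul_apply]

theorem integral_cesaroOp (P : C(X, ℝ) →ₗ[ℝ] C(X, ℝ)) (N : ℕ) (m : Measure X)
    [IsFiniteMeasure m] (ψ : C(X, ℝ)) :
    ∫ x, cesaroOp P N ψ x ∂m = ∑ k ∈ Finset.range N, (N : ℝ)⁻¹ * ∫ x, (P ^ k) ψ x ∂m := by
  simp only [cesaroOp_apply, ContinuousMap.smul_apply, ContinuousMap.sum_apply, smul_eq_mul,
    Finset.mul_sum]
  rw [integral_finsetSum]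
  · simp only [integral_const_mul]
  · intro k _
    exact (((P ^ k) ψ).integrable_of_isFiniteMeasure m).const_mul _

theorem exists_measure_integral_eq_cesaroOp (hw : ∀ i ∈ s, 0 ≤ w i)
    (hsum : ∑ i ∈ s, w i = 1) (m : Measure X) [IsProbabilityMeasure m] {N : ℕ} (hN : N ≠ 0) :
    ∃ m' : Measure X, IsProbabilityMeasure m' ∧
      ∀ ψ : C(X, ℝ), ∫ x, ψ x ∂m' = ∫ x, cesaroOp (markovOp s w h) N ψ x ∂m := by
  choose m₁ hm₁ H₁ using exists_measure_integral_eq_markovOp_pow (h := h) hw hsum m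
  obtain ⟨m', hm', H⟩ := exists_measure_integral_eq_sum (t := Finset.range N)
    (v := fun _ => (N : ℝ)⁻¹) (fun _ _ => by positivity) (by simp [hN]) m₁ hm₁
  refine ⟨m', hm', fun ψ => ?_⟩
  rw [H, integral_cesaroOp]
  simp only [H₁]

theorem abs_integral_le_norm (m : Measure X) [IsProbabilityMeasure m] (ψ : C(X, ℝ)) :
    |∫ x, ψ x ∂m| ≤ ‖ψ‖ := by
  have := norm_integral_le_of_norm_le_const (μ := m) (C := ‖ψ‖)
    (Eventually.of_forall fun x => ψ.norm_coe_le_norm x)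
  simpa using this

/-- Krylov–Bogolyubov: limits of Cesàro averages are stationary measures. -/
theorem exists_stationary_tendsto [TopologicalSpace.MetrizableSpace X]
    (hw : ∀ i ∈ s, 0 ≤ w i)
    (hsum : ∑ i ∈ s, w i = 1) (m : ℕ → Measure X) (hm : ∀ j, IsProbabilityMeasure (m j))
    (N : ℕ → ℕ) (hN : Tendsto N atTop atTop) (U : Ultrafilter ℕ) (hU : (U : Filter ℕ) ≤ atTop) :
    ∃ ν : Measure X, IsProbabilityMeasure ν ∧
      (∀ ψ : C(X, ℝ), ∫ x, markovOp s w h ψ x ∂ν = ∫ x, ψ x ∂ν) ∧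
      ∀ ψ : C(X, ℝ), Tendsto (fun j => ∫ x, cesaroOp (markovOp s w h) (N j) ψ x ∂(m j)) U
        (𝓝 (∫ x, ψ x ∂ν)) := by
  have hex : ∀ j, ∃ m' : ProbabilityMeasure X, N j ≠ 0 → ∀ ψ : C(X, ℝ),
      ∫ x, ψ x ∂(m' : Measure X) = ∫ x, cesaroOp (markovOp s w h) (N j) ψ x ∂(m j) := by
    intro j
    have := hm j
    by_cases h0 : N j = 0
    · exact ⟨⟨m j, hm j⟩, fun h => absurd h0 h⟩
    · obtain ⟨m', hm', H⟩ := exists_measure_integral_eq_cesaroOp (h := h) hw hsum (m j) h0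
      exact ⟨⟨m', hm'⟩, fun _ => H⟩
  choose q hq using hex
  obtain ⟨ν, -, hν⟩ := isCompact_univ.ultrafilter_le_nhds (U.map q) (by simp)
  have hlim : ∀ ψ : C(X, ℝ), Tendsto (fun j => ∫ x, ψ x ∂(q j : Measure X)) U
      (𝓝 (∫ x, ψ x ∂(ν : Measure X))) := fun ψ =>
    ((ProbabilityMeasure.continuous_integral_continuousMap ψ).tendsto ν).comp
      (show Tendsto q U (𝓝 ν) from hν)
  have hne : ∀ᶠ j in (U : Filter ℕ), N j ≠ 0 :=
    hU (hN.eventually_ne_atTop 0)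
  have hlim' : ∀ ψ : C(X, ℝ), Tendsto
      (fun j => ∫ x, cesaroOp (markovOp s w h) (N j) ψ x ∂(m j)) U
      (𝓝 (∫ x, ψ x ∂(ν : Measure X))) := fun ψ =>
    (hlim ψ).congr' (hne.mono fun j hj => hq j hj ψ)
  refine ⟨ν, inferInstance, fun ψ => ?_, hlim'⟩
  -- Stationarity of the limit: applying P before averaging changes the mean only by the telescoped
  -- boundary term, of size at most 2‖ψ‖ / `N j`.
  have h1 := (hlim' (markovOp s w h ψ)).sub (hlim' ψ)
  have h2 : Tendsto (fun j => ∫ x, cesaroOp (markovOp s w h) (N j) (markovOp s w h ψ) x ∂(m j)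
      - ∫ x, cesaroOp (markovOp s w h) (N j) ψ x ∂(m j)) U (𝓝 0) := by
    have h3 : Tendsto (fun j => ((N j : ℕ) : ℝ)⁻¹ * (2 * ‖ψ‖)) U (𝓝 0) := by
      have := (tendsto_inv_atTop_nhds_zero_nat (𝕜 := ℝ)).comp (hN.mono_left hU)
      simpa using this.mul_const (2 * ‖ψ‖)
    refine squeeze_zero_norm (fun j => ?_) h3
    have := hm j
    rw [← integral_sub (ContinuousMap.integrable_of_isFiniteMeasure _ _)
      (ContinuousMap.integrable_of_isFiniteMeasure _ _)]
    have h4 := abs_integral_le_norm (m j) (cesaroOp (markovOp s w h) (N j) (markovOp s w h ψ)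
      - cesaroOp (markovOp s w h) (N j) ψ)
    simp only [ContinuousMap.sub_apply] at h4
    refine h4.trans ?_
    rw [cesaroOp_comp_sub, norm_smul, norm_inv, Real.norm_natCast]
    gcongr
    have := norm_markovOp_pow_le (h := h) hw hsum (N j) ψ
    have := norm_sub_le ((markovOp s w h ^ (N j)) ψ) ψ
    linarith
  exact sub_eq_zero.1 (tendsto_nhds_unique h1 h2)

/-- If the stationary measure is unique, then the Cesàro averages converge uniformly. -/
theorem exists_cesaroOp_near [TopologicalSpace.MetrizableSpace X]
    (hw : ∀ i ∈ s, 0 ≤ w i) (hsum : ∑ i ∈ s, w i = 1) (ν : Measure X)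
    (huniq : ∀ ν' : Measure X, IsProbabilityMeasure ν' →
      (∀ ψ : C(X, ℝ), ∫ x, markovOp s w h ψ x ∂ν' = ∫ x, ψ x ∂ν') → ν' = ν)
    (φ : C(X, ℝ)) {ε : ℝ} (hε : 0 < ε) :
    ∃ N : ℕ, N ≠ 0 ∧ ∀ x, |cesaroOp (markovOp s w h) N φ x - ∫ x, φ x ∂ν| ≤ ε := by
  by_contra! H
  -- Failure of uniform convergence yields bad starting points. Limits of the averages started at
  -- their Dirac masses are stationary, hence equal to ν, against the choice of the points.
  choose x hx using fun N : ℕ => H (N + 1) N.succ_ne_zero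
  obtain ⟨ν', hν', hst, hlim⟩ := exists_stationary_tendsto (h := h) hw hsum
    (fun j => Measure.dirac (x j)) (fun j => inferInstance) (fun j => j + 1)
    (tendsto_add_atTop_nat 1) (Filter.hyperfilter ℕ)
    (by rw [← Nat.cofinite_eq_atTop]; exact Filter.hyperfilter_le_cofinite)
  rw [huniq ν' hν' hst] at hlim
  have h1 := ((hlim φ).sub_const (∫ x, φ x ∂ν)).abs
  simp only [integral_dirac, sub_self, abs_zero] at h1
  obtain ⟨j, hj⟩ := (h1.eventually_lt_const hε).exists
  exact absurd hj (hx j).not_gt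

end MarkovOp

/-! ### Lifts, derivatives and change of variables on the circle -/

theorem UnitAddCircle.coe_eq_coe_iff {s t : ℝ} :
    (s : UnitAddCircle) = (t : UnitAddCircle) ↔ ∃ n : ℤ, s = t + n := by
  rw [← sub_eq_zero, ← AddCircle.coe_sub, AddCircle.coe_eq_zero_iff]
  constructor
  · rintro ⟨n, hn⟩
    exact ⟨n, by simp at hn; linarith⟩
  · rintro ⟨n, hn⟩
    exact ⟨n, by simp [hn]⟩

theorem UnitAddCircle.coe_add_intCast (t : ℝ) (n : ℤ) :
    ((t + n : ℝ) : UnitAddCircle) = (t : UnitAddCircle) :=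
  UnitAddCircle.coe_eq_coe_iff.2 ⟨n, rfl⟩

theorem UnitAddCircle.exists_coe (x : UnitAddCircle) : ∃ t : ℝ, (t : UnitAddCircle) = x :=
  QuotientAddGroup.mk_surjective x

theorem UnitAddCircle.continuous_of_comp_coe {Y : Type*} [TopologicalSpace Y]
    {φ : UnitAddCircle → Y} (hφ : Continuous fun t : ℝ => φ (t : UnitAddCircle)) :
    Continuous φ :=
  QuotientAddGroup.isOpenQuotientMap_mk.isQuotientMap.continuous_iff.2 hφ

/-- The degree k is 1 by injectivity on the circle: the point u with F u = F 0 + 1 must be an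
integer, and 0 < u ≤ 1. -/
theorem IsC1Lift.add_one {F : ℝ → ℝ} {f : CircleHomeo} (hF : IsC1Lift F f) (t : ℝ) :
    F (t + 1) = F t + 1 := by
  obtain ⟨k, hk, hadd⟩ := hF.exists_int
  obtain ⟨u, hu⟩ := hF.surjective (F 0 + 1)
  have h1 : (f (u : UnitAddCircle)) = f ((0 : ℝ) : UnitAddCircle) := by
    rw [hF.lifts, hF.lifts, hu, AddCircle.coe_add_period]
  obtain ⟨n, hn⟩ := UnitAddCircle.coe_eq_coe_iff.1 (f.injective h1)
  have h0 : 0 < u := hF.strictMono.lt_iff_lt.1 (by rw [hu]; linarith)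
  have h2 : u ≤ 1 := by
    have h3 := hadd 0
    rw [zero_add] at h3
    refine hF.strictMono.le_iff_le.1 ?_
    have : (1 : ℝ) ≤ k := by exact_mod_cast hk
    rw [hu, h3]; linarith
  have hn1 : n = 1 := by
    have a : (0 : ℝ) < n := by linarith
    have b : (n : ℝ) ≤ 1 := by linarith
    have a' : 0 < n := by exact_mod_cast a
    have b' : n ≤ 1 := by exact_mod_cast b
    omega
  have hu1 : u = 1 := by rw [hn, hn1]; simp
  have h3 := hadd 0
  rw [zero_add, ← hu1, hu] at h3
  rw [hadd t]; linarith

theorem IsC1Lift.add_intCast {F : ℝ → ℝ} {f : CircleHomeo} (hF : IsC1Lift F f) (t : ℝ) (n : ℤ) :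
    F (t + n) = F t + n := by
  have hnat : ∀ (m : ℕ) (t : ℝ), F (t + m) = F t + m := by
    intro m
    induction m with
    | zero => simp
    | succ m ih =>
      intro t
      push_cast
      rw [← add_assoc, hF.add_one, ih]; ring
  obtain ⟨m, rfl | rfl⟩ := n.eq_nat_or_neg
  · exact_mod_cast hnat m t
  · have := hnat m (t + ((-(m : ℤ) : ℤ) : ℝ))
    push_cast at this ⊢
    rw [neg_add_cancel_right] at this
    linarith

theorem circleDeriv_pos {f : CircleHomeo} (hf : f ∈ circleDiffOne) (x : UnitAddCircle) :
    0 < circleDeriv f x := by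
  obtain ⟨F, hF⟩ := hf
  obtain ⟨t, rfl⟩ := UnitAddCircle.exists_coe x
  rw [hF.circleDeriv_eq]
  exact hF.deriv_pos t

theorem continuous_circleDeriv {f : CircleHomeo} (hf : f ∈ circleDiffOne) :
    Continuous (circleDeriv f) := by
  obtain ⟨F, hF⟩ := hf
  refine UnitAddCircle.continuous_of_comp_coe ?_
  simp only [hF.circleDeriv_eq]
  exact hF.contDiff.continuous_deriv le_rfl

theorem circleDeriv_mul {f g : CircleHomeo} (hf : f ∈ circleDiffOne) (hg : g ∈ circleDiffOne)
    (x : UnitAddCircle) : circleDeriv (f * g : CircleHomeo) x =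
      circleDeriv f (g x) * circleDeriv g x := by
  obtain ⟨F, hF⟩ := hf
  obtain ⟨G, hG⟩ := hg
  obtain ⟨t, rfl⟩ := UnitAddCircle.exists_coe x
  have hFG : IsC1Lift (fun t => F (G t)) (f * g : CircleHomeo) := hF.comp hG
  rw [hFG.circleDeriv_eq, hG.circleDeriv_eq, hG.lifts, hF.circleDeriv_eq]
  exact ((hF.contDiff.differentiable one_ne_zero (G t)).hasDerivAt.comp t
    (hG.contDiff.differentiable one_ne_zero t).hasDerivAt).deriv

theorem circleDeriv_one (x : UnitAddCircle) : circleDeriv (1 : CircleHomeo) x = 1 := by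
  obtain ⟨t, rfl⟩ := UnitAddCircle.exists_coe x
  have h : IsC1Lift (fun t => t) (1 : CircleHomeo) := IsC1Lift.id
  rw [h.circleDeriv_eq]
  simp

theorem circleDeriv_inv_mul {f : CircleHomeo} (hf : f ∈ circleDiffOne) (x : UnitAddCircle) :
    circleDeriv (f⁻¹ : CircleHomeo) (f x) * circleDeriv f x = 1 := by
  rw [← circleDeriv_mul (inv_mem hf) hf, inv_mul_cancel, circleDeriv_one]

/-- Change of variables on the circle. -/
theorem integral_comp_mul_circleDeriv {f : CircleHomeo} (hf : f ∈ circleDiffOne)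
    (φ : C(UnitAddCircle, ℝ)) :
    ∫ x, φ (f x) * circleDeriv f x = ∫ x, φ x := by
  obtain ⟨F, hF⟩ := hf
  have hφ : Continuous fun t : ℝ => φ (t : UnitAddCircle) :=
    φ.continuous.comp (AddCircle.continuous_mk' 1)
  have h1 := intervalIntegral.integral_comp_mul_deriv (a := 0) (b := 0 + 1)
    (f := F) (f' := deriv F) (g := fun t : ℝ => φ (t : UnitAddCircle))
    (fun x _ => (hF.contDiff.differentiable one_ne_zero x).hasDerivAt)
    (hF.contDiff.continuous_deriv le_rfl).continuousOn hφ
  rw [hF.add_one, UnitAddCircle.intervalIntegral_preimage] at h1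
  rw [← h1, ← UnitAddCircle.intervalIntegral_preimage 0]
  simp only [hF.circleDeriv_eq, hF.lifts, Function.comp_apply]

/-! ### Invariant sets, finite orbits and atoms -/

/-- The action of an element of `Γ` on the circle, as a continuous map. -/
def circleAct {Γ : Subgroup CircleHomeo} (g : Γ) : C(UnitAddCircle, UnitAddCircle) :=
  ⟨(g : CircleHomeo), (g : CircleHomeo).continuous⟩

/-- A finitely supported symmetric probability vector on `Γ` whose support generates `Γ` as a
semigroup. -/
structure IsSymmetricWeight {Γ : Subgroup CircleHomeo} (S : Finset Γ) (w : Γ → ℝ) : Prop where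
  pos : ∀ g ∈ S, 0 < w g
  sum_eq : ∑ g ∈ S, w g = 1
  inv_mem : ∀ g ∈ S, g⁻¹ ∈ S
  inv_eq : ∀ g ∈ S, w g⁻¹ = w g
  closure_eq : Subsemigroup.closure (S : Set Γ) = ⊤

theorem IsSymmetricWeight.nonneg {Γ : Subgroup CircleHomeo} {S : Finset Γ} {w : Γ → ℝ}
    (hS : IsSymmetricWeight S w) : ∀ g ∈ S, 0 ≤ w g := fun g hg => (hS.pos g hg).le

/-- Products suffice because S generates as a semigroup; no inverses have to be taken. -/
theorem mem_of_forall_generator {Γ : Subgroup CircleHomeo} {S : Set Γ}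
    (hS : Subsemigroup.closure S = ⊤) {A : Set UnitAddCircle}
    (hA : ∀ g ∈ S, ∀ x ∈ A, (g : CircleHomeo) x ∈ A) (g : Γ) :
    ∀ x ∈ A, (g : CircleHomeo) x ∈ A := by
  have hg : g ∈ Subsemigroup.closure S := by rw [hS]; trivial
  induction hg using Subsemigroup.closure_induction with
  | mem g hg => exact hA g hg
  | mul g₁ g₂ _ _ h₁ h₂ => exact fun x hx => h₁ _ (h₂ x hx)

/-- The uniform measure on the set works, since each element of the group permutes it. Every later
contradiction with the absence of an invariant measure that starts from a finite set passes through
here. -/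
theorem exists_preservesMeasure_of_finite {Γ : Subgroup CircleHomeo} {E : Set UnitAddCircle}
    (hfin : E.Finite) (hne : E.Nonempty) (hE : ∀ g : Γ, ∀ x ∈ E, (g : CircleHomeo) x ∈ E) :
    ∃ ν : Measure UnitAddCircle, IsProbabilityMeasure ν ∧ PreservesMeasure Γ ν := by
  lift E to Finset UnitAddCircle using hfin
  have hcard : (E.card : ENNReal) ≠ 0 := by
    simpa using hne.ne_empty
  refine ⟨(E.card : ENNReal)⁻¹ • ∑ x ∈ E, Measure.dirac x, ⟨?_⟩, fun g hg => ?_⟩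
  · simp [Measure.coe_finsetSum, ENNReal.inv_mul_cancel hcard]
  · ext A hA
    rw [Measure.map_apply g.continuous.measurable hA]
    simp only [Measure.smul_apply, Measure.coe_finsetSum, Finset.sum_apply]
    congr 1
    refine Finset.sum_bij (fun x _ => g x) (fun x hx => hE ⟨g, hg⟩ x hx)
      (fun x _ y _ hxy => g.injective hxy) (fun y hy => ?_) (fun x _ => ?_)
    · exact ⟨g.symm y, hE ⟨g⁻¹, inv_mem hg⟩ y hy, g.apply_symm_apply y⟩
    · rw [Measure.dirac_apply' _ (g.continuous.measurable hA), Measure.dirac_apply' _ hA]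
      rfl

section Stationary

variable {Γ : Subgroup CircleHomeo} {S : Finset Γ} {w : Γ → ℝ}

theorem measure_eq_sum_map (hS : IsSymmetricWeight S w) {ν : Measure UnitAddCircle}
    [IsProbabilityMeasure ν]
    (hν : ∀ ψ : C(UnitAddCircle, ℝ), ∫ x, markovOp S w circleAct ψ x ∂ν = ∫ x, ψ x ∂ν) :
    ν = ∑ g ∈ S, ENNReal.ofReal (w g) • ν.map (g : CircleHomeo) := by
  have hmap : ∀ g : Γ, IsProbabilityMeasure (ν.map (g : CircleHomeo)) := fun g =>
    Measure.isProbabilityMeasure_map (g : CircleHomeo).continuous.measurable.aemeasurable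
  have : IsFiniteMeasure (∑ g ∈ S, ENNReal.ofReal (w g) • ν.map (g : CircleHomeo)) := by
    constructor
    simp only [Measure.coe_finsetSum, Finset.sum_apply, Measure.smul_apply, measure_univ,
      smul_eq_mul, mul_one]
    exact ENNReal.sum_lt_top.2 fun g _ => ENNReal.ofReal_lt_top
  refine ext_of_forall_integral_eq_of_IsFiniteMeasure fun ψ => ?_
  rw [integral_finsetSum_measure]
  swap
  · exact fun g _ => (ψ.integrable _).smul_measure ENNReal.ofReal_ne_top
  refine (hν ψ.toContinuousMap).symm.trans ?_
  rw [integral_markovOp]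
  refine Finset.sum_congr rfl fun g hg => ?_
  rw [integral_smul_measure, ENNReal.toReal_ofReal (hS.nonneg g hg), smul_eq_mul,
    integral_map (g : CircleHomeo).continuous.measurable.aemeasurable
      ψ.continuous.aestronglyMeasurable]
  rfl

/-- Extends stationarity beyond continuous functions, as needed for indicators of points and for the
integer parts that define `liftCdf`. -/
theorem integral_eq_sum_of_stationary (hS : IsSymmetricWeight S w) {ν : Measure UnitAddCircle}
    [IsProbabilityMeasure ν]
    (hν : ∀ ψ : C(UnitAddCircle, ℝ), ∫ x, markovOp S w circleAct ψ x ∂ν = ∫ x, ψ x ∂ν)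
    {φ : UnitAddCircle → ℝ} (hφ : Measurable φ) {C : ℝ} (hC : ∀ x, |φ x| ≤ C) :
    ∫ x, φ x ∂ν = ∑ g ∈ S, w g * ∫ x, φ ((g : CircleHomeo) x) ∂ν := by
  have hmap : ∀ g : Γ, IsProbabilityMeasure (ν.map (g : CircleHomeo)) := fun g =>
    Measure.isProbabilityMeasure_map (g : CircleHomeo).continuous.measurable.aemeasurable
  conv_lhs => rw [measure_eq_sum_map hS hν]
  rw [integral_finsetSum_measure (fun g _ => (Integrable.of_bound
    hφ.aestronglyMeasurable C (Eventually.of_forall hC)).smul_measure ENNReal.ofReal_ne_top)]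
  refine Finset.sum_congr rfl fun g hg => ?_
  rw [integral_smul_measure, ENNReal.toReal_ofReal (hS.nonneg g hg), smul_eq_mul,
    integral_map (g : CircleHomeo).continuous.measurable.aemeasurable
      hφ.aestronglyMeasurable]

/-- Equality case of the maximum principle: the deficits w g (M - a g) are nonnegative and their sum
is not positive. -/
theorem eq_of_sum_weight_eq (hpos : ∀ g ∈ S, 0 < w g) (hsum : ∑ g ∈ S, w g = 1) {a : Γ → ℝ}
    {M : ℝ} (ha : ∀ g ∈ S, a g ≤ M) (hM : M ≤ ∑ g ∈ S, w g * a g) : ∀ g ∈ S, a g = M := by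
  have h1 : ∑ g ∈ S, w g * (M - a g) = M - ∑ g ∈ S, w g * a g := by
    simp only [mul_sub, Finset.sum_sub_distrib, ← Finset.sum_mul, hsum, one_mul]
  have h2 : ∀ g ∈ S, 0 ≤ w g * (M - a g) := fun g hg =>
    mul_nonneg (hpos g hg).le (sub_nonneg.2 (ha g hg))
  have h3 := (Finset.sum_eq_zero_iff_of_nonneg h2).1
    (le_antisymm (by linarith) (Finset.sum_nonneg h2))
  intro g hg
  rcases mul_eq_zero.1 (h3 g hg) with h | h
  · exact absurd h (hpos g hg).ne'
  · linarith

theorem finite_setOf_le_measureReal_singleton (ν : Measure UnitAddCircle)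
    [IsProbabilityMeasure ν] {c : ℝ} (hc : 0 < c) : {x | c ≤ ν.real {x}}.Finite := by
  by_contra hinf
  obtain ⟨n, hn⟩ := exists_nat_gt (1 / c)
  obtain ⟨T, hT, hcard⟩ := Set.Infinite.exists_subset_card_eq hinf n
  have h1 : ∑ x ∈ T, ν.real {x} = ν.real (T : Set UnitAddCircle) := by
    rw [sum_measureReal_singleton]
  have h2 : (T.card : ℝ) * c ≤ ∑ x ∈ T, ν.real {x} := by
    rw [← nsmul_eq_mul]
    exact Finset.card_nsmul_le_sum _ _ _ fun x hx => hT hx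
  have h3 : ν.real (T : Set UnitAddCircle) ≤ 1 := measureReal_le_one
  rw [div_lt_iff₀ hc] at hn
  rw [hcard] at h2
  linarith

/-- A stationary measure without invariant measures around has no atom. -/
theorem measureReal_singleton_eq_zero (hS : IsSymmetricWeight S w)
    (hinv : ¬ ∃ ν : Measure UnitAddCircle, IsProbabilityMeasure ν ∧ PreservesMeasure Γ ν)
    {ν : Measure UnitAddCircle} [IsProbabilityMeasure ν]
    (hν : ∀ ψ : C(UnitAddCircle, ℝ), ∫ x, markovOp S w circleAct ψ x ∂ν = ∫ x, ψ x ∂ν)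
    (x₀ : UnitAddCircle) : ν.real {x₀} = 0 := by
  by_contra hx₀
  have hpos : 0 < ν.real {x₀} := lt_of_le_of_ne measureReal_nonneg (Ne.symm hx₀)
  have hfin := finite_setOf_le_measureReal_singleton ν hpos
  obtain ⟨x₁, hx₁, hmax⟩ := Set.exists_max_image _ (fun x => ν.real {x}) hfin ⟨x₀, by simp⟩
  have hx₁' : ν.real {x₀} ≤ ν.real {x₁} := hx₁
  have hmax' : ∀ x, ν.real {x} ≤ ν.real {x₁} := fun x => by
    by_cases h : ν.real {x₀} ≤ ν.real {x}
    · exact hmax x h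
    · exact (not_le.1 h).le.trans hx₁'
  have hst : ∀ x, ν.real {x} =
      ∑ g ∈ S, w g * ν.real {((g⁻¹ : Γ) : CircleHomeo) x} := by
    intro x
    have h := integral_eq_sum_of_stationary hS hν (φ := Set.indicator {x} 1)
      (measurable_one.indicator (measurableSet_singleton x)) (C := 1)
      (fun y => by by_cases hy : y ∈ ({x} : Set UnitAddCircle) <;> simp [hy])
    rw [integral_indicator_one (measurableSet_singleton x)] at h
    rw [h]
    refine Finset.sum_congr rfl fun g _ => ?_
    congr 1
    rw [← integral_indicator_one (measurableSet_singleton _)]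
    congr 1
    ext y
    have : (g : CircleHomeo) y = x ↔ y = ((g⁻¹ : Γ) : CircleHomeo) x := by
      constructor
      · rintro rfl; exact ((g : CircleHomeo).symm_apply_apply y).symm
      · rintro rfl; exact (g : CircleHomeo).apply_symm_apply x
    simp only [Set.indicator, Set.mem_singleton_iff, this, Pi.one_apply]
  -- The atoms of maximal mass are finite in number. `hst` averages over preimages, so the equality
  -- case is read at g⁻¹, which lies in S by symmetry, to obtain invariance under g.
  refine hinv (exists_preservesMeasure_of_finite (E := {x | ν.real {x} = ν.real {x₁}})
    (hfin.subset fun x hx => ?_) ⟨x₁, rfl⟩ ?_)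
  · rw [Set.mem_ofPred_eq] at hx ⊢
    rw [hx]; exact hx₁'
  · refine fun g => mem_of_forall_generator hS.closure_eq (fun g hg x hx => ?_) g
    have := eq_of_sum_weight_eq hS.pos hS.sum_eq
      (a := fun g => ν.real {((g⁻¹ : Γ) : CircleHomeo) x}) (M := ν.real {x₁})
      (fun g _ => hmax' _) (by rw [← hst]; exact (Set.mem_ofPred_eq ▸ hx).ge) g⁻¹ (hS.inv_mem g hg)
    simpa using this

end Stationary

/-- If a group of circle diffeomorphisms has two disjoint nonempty closed invariant sets,
then it has a finite orbit. -/
theorem exists_finite_invariant_of_disjoint {Γ : Subgroup CircleHomeo} (hΓ : Γ ≤ circleDiffOne)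
    {A B : Set UnitAddCircle} (hA : IsClosed A) (hB : IsClosed B) (hAne : A.Nonempty)
    (hBne : B.Nonempty) (hdisj : Disjoint A B)
    (hAinv : ∀ g : Γ, ∀ x ∈ A, (g : CircleHomeo) x ∈ A)
    (hBinv : ∀ g : Γ, ∀ x ∈ B, (g : CircleHomeo) x ∈ B) :
    ∃ E : Set UnitAddCircle, E.Finite ∧ E.Nonempty ∧
      ∀ g : Γ, ∀ x ∈ E, (g : CircleHomeo) x ∈ E := by
  let π : ℝ → UnitAddCircle := fun t => (t : UnitAddCircle)
  have hπ : Continuous π := AddCircle.continuous_mk' 1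
  have hAc : IsClosed (π ⁻¹' A) := hA.preimage hπ
  have hBc : IsClosed (π ⁻¹' B) := hB.preimage hπ
  have hper : ∀ (t : ℝ) (n : ℤ), π (t + n) = π t := UnitAddCircle.coe_add_intCast
  -- Last points of A before a point of B, on the line. Increasing lifts that preserve A and B
  -- preserve this set.
  let E : Set ℝ := {a | π a ∈ A ∧ ∃ b, π b ∈ B ∧ a < b ∧ ∀ y, a < y → y < b → π y ∉ A}
  have hEper : ∀ a ∈ E, ∀ n : ℤ, a + n ∈ E := by
    rintro a ⟨ha, b, hb, hab, hE⟩ n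
    refine ⟨by rwa [hper], b + n, by rwa [hper], by linarith, fun y h1 h2 => ?_⟩
    have := hE (y - n) (by linarith) (by linarith)
    rwa [← hper _ n, sub_add_cancel] at this
  have himage : π '' E = π '' (E ∩ Set.Icc 0 1) := by
    refine Set.Subset.antisymm ?_ (Set.image_mono Set.inter_subset_left)
    rintro _ ⟨a, ha, rfl⟩
    refine ⟨a + ((-⌊a⌋ : ℤ) : ℝ), ⟨hEper a ha _, ?_, ?_⟩, hper _ _⟩
    · push_cast; linarith [Int.floor_le a]
    · push_cast; linarith [Int.lt_floor_add_one a]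
  refine ⟨π '' E, ?_, ?_, ?_⟩
  · rw [himage]
    refine Set.Finite.image _ ?_
    -- Two distinct points of E are separated by a point of B, so they are at least the distance
    -- from A to B apart. Cutting to one period gives the compactness that makes this distance
    -- positive.
    obtain ⟨r, hr, hdist⟩ := Metric.exists_pos_forall_lt_edist
      (s := π ⁻¹' A ∩ Set.Icc 0 1) (t := π ⁻¹' B)
      (isCompact_Icc.inter_left hAc) hBc
      (Set.disjoint_left.2 fun t ht ht' => Set.disjoint_left.1 hdisj ht.1 ht')
    have hr' : (0 : ℝ) < r := hr
    have hgap : ∀ a ∈ E ∩ Set.Icc 0 1, ∀ a' ∈ E ∩ Set.Icc 0 1, a < a' → r < a' - a := by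
      rintro a ⟨⟨ha, b, hb, hab, hE⟩, haI⟩ a' ⟨⟨ha', -⟩, -⟩ haa'
      have h1 : b ≤ a' := by
        by_contra! h
        exact hE a' haa' h ha'
      have h2 := hdist a ⟨ha, haI⟩ b hb
      rw [edist_nndist, ENNReal.coe_lt_coe, ← NNReal.coe_lt_coe, coe_nndist, Real.dist_eq,
        abs_sub_comm, abs_of_pos (by linarith)] at h2
      linarith
    -- Points with the same value of ⌊a / r⌋ are less than r apart, so the gap makes this map
    -- injective on E, with values in a finite range.
    refine Set.Finite.of_finite_image (f := fun a : ℝ => ⌊a / r⌋)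
      ((Set.finite_Icc (0 : ℤ) ⌊(1 : ℝ) / r⌋).subset ?_) ?_
    · rintro _ ⟨a, ⟨-, ha0, ha1⟩, rfl⟩
      exact ⟨Int.floor_nonneg.2 (by positivity), Int.floor_le_floor (by gcongr)⟩
    · intro a ha a' ha' heq
      have h1 := Int.abs_sub_lt_one_of_floor_eq_floor heq
      rw [← sub_div, abs_div, abs_of_pos hr', div_lt_one hr'] at h1
      rcases lt_trichotomy a a' with h | h | h
      · have := hgap a ha a' ha' h
        rw [abs_sub_comm, abs_of_pos (by linarith)] at h1
        linarith
      · exact h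
      · have := hgap a' ha' a ha h
        rw [abs_of_pos (by linarith)] at h1
        linarith
  · refine Set.Nonempty.image _ ?_
    obtain ⟨x, ha⟩ := hAne
    obtain ⟨a, rfl⟩ := UnitAddCircle.exists_coe x
    obtain ⟨y, hb⟩ := hBne
    obtain ⟨b₀, rfl⟩ := UnitAddCircle.exists_coe y
    obtain ⟨b, hb, hab⟩ : ∃ b, π b ∈ B ∧ a < b := by
      obtain ⟨n, hn⟩ := exists_nat_gt (a - b₀)
      refine ⟨b₀ + (n : ℤ), by rw [hper]; exact hb, ?_⟩
      push_cast; linarith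
    have hne : (π ⁻¹' A ∩ Set.Iic b).Nonempty := ⟨a, ha, hab.le⟩
    have hbdd : BddAbove (π ⁻¹' A ∩ Set.Iic b) := ⟨b, fun y hy => hy.2⟩
    have hmem := (hAc.inter isClosed_Iic).csSup_mem hne hbdd
    refine ⟨sSup (π ⁻¹' A ∩ Set.Iic b), hmem.1, b, hb, lt_of_le_of_ne hmem.2 fun h => ?_,
      fun y h1 h2 hy => ?_⟩
    · rw [h] at hmem
      exact Set.disjoint_left.1 hdisj hmem.1 hb
    · exact absurd (le_csSup hbdd ⟨hy, h2.le⟩) h1.not_ge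
  · rintro g _ ⟨a, ⟨ha, b, hb, hab, hE⟩, rfl⟩
    obtain ⟨F, hF⟩ := hΓ g.2
    refine ⟨F a, ⟨?_, F b, ?_, hF.strictMono hab, fun y h1 h2 hy => ?_⟩, (hF.lifts a).symm⟩
    · have := hAinv g _ ha
      rwa [hF.lifts] at this
    · have := hBinv g _ hb
      rwa [hF.lifts] at this
    · obtain ⟨u, rfl⟩ := hF.surjective y
      refine hE u (hF.strictMono.lt_iff_lt.1 h1) (hF.strictMono.lt_iff_lt.1 h2) ?_
      have := hAinv g⁻¹ _ hy
      have h3 : π (F u) = (g : CircleHomeo) (π u) := (hF.lifts u).symm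
      rw [h3] at this
      exact ((g : CircleHomeo).symm_apply_apply (π u)) ▸ this

/-! ### Uniqueness of the stationary measure -/

/-- The representative in `(0, 1]` of a point of the circle. -/
noncomputable def circleRep (x : UnitAddCircle) : ℝ := (AddCircle.equivIoc (1 : ℝ) 0 x : ℝ)

theorem circleRep_mem (x : UnitAddCircle) : circleRep x ∈ Set.Ioc (0 : ℝ) 1 := by
  have h := (AddCircle.equivIoc (1 : ℝ) 0 x).2
  exact ⟨h.1, h.2.trans_eq (zero_add 1)⟩

theorem coe_circleRep (x : UnitAddCircle) : (circleRep x : UnitAddCircle) = x :=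
  AddCircle.coe_equivIoc

theorem measurable_circleRep : Measurable circleRep :=
  measurable_subtype_coe.comp (AddCircle.measurableEquivIoc (1 : ℝ) 0).measurable

/-- A distribution function of the lift to `ℝ` of a measure on the circle. -/
noncomputable def liftCdf (ν : Measure UnitAddCircle) (t : ℝ) : ℝ :=
  ∫ x, (⌊t - circleRep x⌋ : ℝ) ∂ν

theorem abs_floor_sub_circleRep_le (t : ℝ) (x : UnitAddCircle) :
    |(⌊t - circleRep x⌋ : ℝ)| ≤ |t| + 2 := by
  have h := circleRep_mem x
  rw [abs_le]
  constructor
  · linarith [Int.sub_one_lt_floor (t - circleRep x), neg_abs_le t, h.2]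
  · linarith [Int.floor_le (t - circleRep x), le_abs_self t, h.1]

theorem measurable_floor_sub_circleRep (t : ℝ) :
    Measurable fun x => (⌊t - circleRep x⌋ : ℝ) :=
  (measurable_of_countable fun n : ℤ => (n : ℝ)).comp
    (Int.measurable_floor.comp (measurable_const.sub measurable_circleRep))

theorem integrable_floor_sub_circleRep (ν : Measure UnitAddCircle) [IsProbabilityMeasure ν]
    (t : ℝ) : Integrable (fun x => (⌊t - circleRep x⌋ : ℝ)) ν :=
  Integrable.of_bound (measurable_floor_sub_circleRep t).aestronglyMeasurable (|t| + 2)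
    (Eventually.of_forall (abs_floor_sub_circleRep_le t))

theorem liftCdf_add_intCast (ν : Measure UnitAddCircle) [IsProbabilityMeasure ν] (t : ℝ) (n : ℤ) :
    liftCdf ν (t + n) = liftCdf ν t + n := by
  have h : ∀ x, (⌊t + n - circleRep x⌋ : ℝ) = (⌊t - circleRep x⌋ : ℝ) + n := fun x => by
    rw [add_sub_right_comm, Int.floor_add_intCast]; push_cast; rfl
  simp only [liftCdf, h]
  rw [integral_add (integrable_floor_sub_circleRep ν t) (integrable_const _)]
  simp

theorem continuousAt_intFloor {t : ℝ} (ht : ∀ n : ℤ, t ≠ n) :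
    ContinuousAt (fun t : ℝ => (⌊t⌋ : ℝ)) t := by
  have h : (fun t : ℝ => (⌊t⌋ : ℝ)) =ᶠ[𝓝 t] fun _ => (⌊t⌋ : ℝ) := by
    filter_upwards [Ioo_mem_nhds (lt_of_le_of_ne (Int.floor_le t) (ht _).symm)
      (Int.lt_floor_add_one t)] with s hs
    rw [Int.floor_eq_iff.2 ⟨hs.1.le, hs.2⟩]
  exact continuousAt_const.congr h.symm

theorem continuous_liftCdf (ν : Measure UnitAddCircle) [IsProbabilityMeasure ν]
    (hν : ∀ x, ν.real {x} = 0) : Continuous (liftCdf ν) := by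
  rw [continuous_iff_continuousAt]
  intro t
  refine continuousAt_of_dominated (bound := fun _ => |t| + 3)
    (Eventually.of_forall fun s => (measurable_floor_sub_circleRep s).aestronglyMeasurable)
    ?_ (integrable_const _) ?_
  · filter_upwards [Metric.ball_mem_nhds t one_pos] with s hs
    refine Eventually.of_forall fun x => ?_
    rw [Metric.mem_ball, Real.dist_eq] at hs
    have h1 := abs_floor_sub_circleRep_le s x
    have h2 := abs_sub_abs_le_abs_sub s t
    rw [Real.norm_eq_abs]
    linarith
  · have h0 : ν {(t : UnitAddCircle)} = 0 := by
      have := hν (t : UnitAddCircle)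
      rwa [measureReal_eq_zero_iff] at this
    filter_upwards [measure_eq_zero_iff_ae_notMem.1 h0] with x hx
    have h1 : ContinuousAt (fun t : ℝ => (⌊t⌋ : ℝ)) (t - circleRep x) := by
      refine continuousAt_intFloor fun n hn => hx ?_
      rw [Set.mem_singleton_iff, ← coe_circleRep x, eq_comm, UnitAddCircle.coe_eq_coe_iff]
      exact ⟨n, by linarith⟩
    exact ContinuousAt.comp (f := fun s => s - circleRep x) h1 (by fun_prop)

/-- F is increasing and commutes with integer translations, so u + n ≤ t is equivalent to F u + n ≤
F t. -/
theorem IsC1Lift.floor_sub {F : ℝ → ℝ} {f : CircleHomeo} (hF : IsC1Lift F f) (t u : ℝ) :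
    ⌊F t - F u⌋ = ⌊t - u⌋ := by
  have key : ∀ n : ℤ, n ≤ ⌊F t - F u⌋ ↔ n ≤ ⌊t - u⌋ := fun n => by
    rw [Int.le_floor, Int.le_floor, le_sub_iff_add_le', ← hF.add_intCast,
      hF.strictMono.le_iff_le, le_sub_iff_add_le']
  exact le_antisymm ((key _).1 le_rfl) ((key _).2 le_rfl)

/-- The representative of f x differs from F of the representative of x by an integer. This unknown
integer cancels in increments, which is why base point 0 is subtracted throughout. -/
theorem IsC1Lift.floor_sub_circleRep {F : ℝ → ℝ} {f : CircleHomeo} (hF : IsC1Lift F f)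
    (t : ℝ) (x : UnitAddCircle) :
    (⌊F t - circleRep (f x)⌋ : ℝ) - ⌊F 0 - circleRep (f x)⌋ =
      ⌊t - circleRep x⌋ - ⌊0 - circleRep x⌋ := by
  have h : ((circleRep (f x) : ℝ) : UnitAddCircle) = (F (circleRep x) : UnitAddCircle) := by
    rw [coe_circleRep, ← hF.lifts, coe_circleRep]
  obtain ⟨n, hn⟩ := UnitAddCircle.coe_eq_coe_iff.1 h
  have key : ∀ t, ⌊F t - circleRep (f x)⌋ = ⌊t - circleRep x⌋ - n := fun t => by
    rw [hn, ← sub_sub, Int.floor_sub_intCast, hF.floor_sub]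
  rw [key, key]
  push_cast
  ring

section Uniqueness

variable {Γ : Subgroup CircleHomeo} {S : Finset Γ} {w : Γ → ℝ}

/-- The mass of an interval is the average of the masses of its preimages. The symmetry of w turns
preimages into images, so that the distribution function is composed with the lifts F g, as in P. -/
theorem liftCdf_sub_eq_sum (hS : IsSymmetricWeight S w)
    {ν : Measure UnitAddCircle} [IsProbabilityMeasure ν]
    (hν : ∀ ψ : C(UnitAddCircle, ℝ), ∫ x, markovOp S w circleAct ψ x ∂ν = ∫ x, ψ x ∂ν)
    {F : Γ → ℝ → ℝ} (hF : ∀ g : Γ, IsC1Lift (F g) (g : CircleHomeo)) (t : ℝ) :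
    liftCdf ν t - liftCdf ν 0 = ∑ g ∈ S, w g * (liftCdf ν (F g t) - liftCdf ν (F g 0)) := by
  have h1 := integral_eq_sum_of_stationary hS hν
    ((measurable_floor_sub_circleRep t).sub (measurable_floor_sub_circleRep 0))
    (C := (|t| + 2) + (|0| + 2)) (fun x => (abs_sub _ _).trans
      (add_le_add (abs_floor_sub_circleRep_le t x) (abs_floor_sub_circleRep_le 0 x)))
  simp only [Pi.sub_apply] at h1
  rw [integral_sub (integrable_floor_sub_circleRep ν t) (integrable_floor_sub_circleRep ν 0)] at h1
  simp only [liftCdf]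
  rw [h1]
  refine Finset.sum_bij (fun g _ => g⁻¹) (fun g hg => hS.inv_mem g hg)
    (fun g _ g' _ h => inv_injective h)
    (fun g hg => ⟨g⁻¹, hS.inv_mem g hg, inv_inv g⟩) (fun g hg => ?_)
  rw [hS.inv_eq g hg]
  congr 1
  rw [← integral_sub (integrable_floor_sub_circleRep ν _) (integrable_floor_sub_circleRep ν _)]
  congr 1
  ext x
  have h2 := (hF g⁻¹).floor_sub_circleRep t ((g : CircleHomeo) x)
  have h3 : ((g⁻¹ : Γ) : CircleHomeo) ((g : CircleHomeo) x) = x :=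
    (g : CircleHomeo).symm_apply_apply x
  rw [h3] at h2
  exact h2.symm

/-- A continuous function which is harmonic up to an additive constant is constant. -/
theorem eq_const_of_markovOp_eq (hΓ : Γ ≤ circleDiffOne)
    (hpos : ∀ g ∈ S, 0 < w g) (hsum : ∑ g ∈ S, w g = 1)
    (hgen : Subsemigroup.closure (S : Set Γ) = ⊤)
    (hinv : ¬ ∃ ν : Measure UnitAddCircle, IsProbabilityMeasure ν ∧ PreservesMeasure Γ ν)
    (G : C(UnitAddCircle, ℝ)) (c : ℝ)
    (hG : ∀ x, ∑ g ∈ S, w g * G ((g : CircleHomeo) x) = G x - c) (x y : UnitAddCircle) :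
    G x = G y := by
  obtain ⟨a, -, ha⟩ := isCompact_univ.exists_isMaxOn ⟨x, trivial⟩ G.continuous.continuousOn
  obtain ⟨b, -, hb⟩ := isCompact_univ.exists_isMinOn ⟨x, trivial⟩ G.continuous.continuousOn
  have ha' : ∀ z, G z ≤ G a := fun z => ha (Set.mem_univ z)
  have hb' : ∀ z, G b ≤ G z := fun z => hb (Set.mem_univ z)
  -- Evaluation at a maximum gives c ≥ 0, and at a minimum c ≤ 0.
  have hc0 : 0 ≤ c := by
    have h1 : ∑ g ∈ S, w g * G ((g : CircleHomeo) a) ≤ ∑ g ∈ S, w g * G a :=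
      Finset.sum_le_sum fun g hg => mul_le_mul_of_nonneg_left (ha' _) (hpos g hg).le
    rw [hG, ← Finset.sum_mul, hsum] at h1
    linarith
  have hc1 : c ≤ 0 := by
    have h1 : ∑ g ∈ S, w g * G b ≤ ∑ g ∈ S, w g * G ((g : CircleHomeo) b) :=
      Finset.sum_le_sum fun g hg => mul_le_mul_of_nonneg_left (hb' _) (hpos g hg).le
    rw [hG, ← Finset.sum_mul, hsum] at h1
    linarith
  obtain rfl : c = 0 := le_antisymm hc1 hc0
  by_contra hxy
  have hab : G b ≠ G a := fun h => hxy (by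
    linarith [ha' x, ha' y, hb' x, hb' y])
  have hAinv : ∀ g : Γ, ∀ z ∈ G ⁻¹' {G a}, (g : CircleHomeo) z ∈ G ⁻¹' {G a} := fun g =>
    mem_of_forall_generator hgen (fun g hg z hz => eq_of_sum_weight_eq hpos hsum
      (a := fun g : Γ => G ((g : CircleHomeo) z)) (fun g _ => ha' _)
      (by rw [hG, sub_zero]; exact (show G z = G a from hz).ge) g hg) g
  have hBinv : ∀ g : Γ, ∀ z ∈ G ⁻¹' {G b}, (g : CircleHomeo) z ∈ G ⁻¹' {G b} := fun g =>
    mem_of_forall_generator hgen (fun g hg z hz => by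
      have := eq_of_sum_weight_eq hpos hsum (M := -G b)
        (a := fun g : Γ => -G ((g : CircleHomeo) z)) (fun g _ => neg_le_neg (hb' _))
        (by
          simp only [mul_neg, Finset.sum_neg_distrib]
          rw [hG, sub_zero]; exact (neg_le_neg (show G z = G b from hz).le)) g hg
      exact neg_injective this) g
  obtain ⟨E, hEfin, hEne, hE⟩ := exists_finite_invariant_of_disjoint hΓ
    (isClosed_singleton.preimage G.continuous) (isClosed_singleton.preimage G.continuous)
    (A := G ⁻¹' {G a}) (B := G ⁻¹' {G b}) ⟨a, rfl⟩ ⟨b, rfl⟩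
    (Set.disjoint_left.2 fun z hz hz' =>
      hab ((show G z = G b from hz').symm.trans (show G z = G a from hz))) hAinv hBinv
  exact hinv (exists_preservesMeasure_of_finite hEfin hEne hE)

theorem liftCdf_of_mem_Ico (ν : Measure UnitAddCircle) [IsProbabilityMeasure ν] {t : ℝ}
    (ht : t ∈ Set.Ico (0 : ℝ) 1) : liftCdf ν t = -1 + ν.real {x | circleRep x ≤ t} := by
  have hm : MeasurableSet {x | circleRep x ≤ t} := measurable_circleRep measurableSet_Iic
  have h : ∀ x, (⌊t - circleRep x⌋ : ℝ) = -1 + Set.indicator {x | circleRep x ≤ t} 1 x := by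
    intro x
    have hx := circleRep_mem x
    by_cases hxt : circleRep x ≤ t
    · have h1 : ⌊t - circleRep x⌋ = 0 :=
        Int.floor_eq_iff.2 ⟨by push_cast; linarith, by push_cast; linarith [ht.2, hx.1]⟩
      simp [h1, hxt]
    · have h1 : ⌊t - circleRep x⌋ = -1 :=
        Int.floor_eq_iff.2 ⟨by push_cast; linarith [ht.1, hx.2], by push_cast; linarith⟩
      simp [h1, hxt]
  simp only [liftCdf, h]
  rw [integral_add (integrable_const _) ((integrable_const 1).indicator hm),
    integral_indicator_one hm]
  simp

/-- Representatives lie in (0, 1], so every `liftCdf` takes the value -1 at 0. The two functions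
then coincide, and on [0, 1) they determine the measures carried to the line by `circleRep`. -/
theorem eq_of_liftCdf_eq {ν₁ ν₂ : Measure UnitAddCircle} [IsProbabilityMeasure ν₁]
    [IsProbabilityMeasure ν₂] (h : ∀ t, liftCdf ν₁ t - liftCdf ν₂ t = liftCdf ν₁ 0 - liftCdf ν₂ 0) :
    ν₁ = ν₂ := by
  have h0 : ∀ (ν : Measure UnitAddCircle) [IsProbabilityMeasure ν], liftCdf ν 0 = -1 := by
    intro ν _
    rw [liftCdf_of_mem_Ico ν (by simp)]
    have : {x | circleRep x ≤ 0} = ∅ := by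
      ext x; simpa using (circleRep_mem x).1
    simp [this]
  have hmap : ∀ ν : Measure UnitAddCircle,
      (ν.map circleRep).map (fun t : ℝ => (t : UnitAddCircle)) = ν := by
    intro ν
    rw [Measure.map_map AddCircle.measurable_mk' measurable_circleRep]
    have : (fun t : ℝ => (t : UnitAddCircle)) ∘ circleRep = id := by
      ext x; exact coe_circleRep x
    rw [this, Measure.map_id]
  have hprob : ∀ (ν : Measure UnitAddCircle) [IsProbabilityMeasure ν],
      IsProbabilityMeasure (ν.map circleRep) := fun ν _ =>
    Measure.isProbabilityMeasure_map measurable_circleRep.aemeasurable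
  have := hprob ν₁
  have := hprob ν₂
  rw [← hmap ν₁, ← hmap ν₂]
  congr 1
  refine Measure.ext_of_Iic _ _ fun t => ?_
  rw [Measure.map_apply measurable_circleRep measurableSet_Iic,
    Measure.map_apply measurable_circleRep measurableSet_Iic]
  rcases lt_or_ge t 0 with ht | ht
  · have : circleRep ⁻¹' Set.Iic t = ∅ := by
      ext x
      simpa using ht.trans (circleRep_mem x).1
    simp [this]
  rcases lt_or_ge t 1 with ht1 | ht1
  · have h1 := h t
    rw [h0, h0, liftCdf_of_mem_Ico ν₁ ⟨ht, ht1⟩, liftCdf_of_mem_Ico ν₂ ⟨ht, ht1⟩] at h1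
    have h2 : ν₁.real {x | circleRep x ≤ t} = ν₂.real {x | circleRep x ≤ t} := by linarith
    exact (measureReal_eq_measureReal_iff).1 h2
  · have : circleRep ⁻¹' Set.Iic t = Set.univ := by
      ext x
      simpa using (circleRep_mem x).2.trans ht1
    simp [this]

/-- Uniqueness of the stationary measure of a symmetric random walk without invariant measure. -/
theorem stationary_unique (hΓ : Γ ≤ circleDiffOne) (hS : IsSymmetricWeight S w)
    (hinv : ¬ ∃ ν : Measure UnitAddCircle, IsProbabilityMeasure ν ∧ PreservesMeasure Γ ν)
    {ν₁ ν₂ : Measure UnitAddCircle} [IsProbabilityMeasure ν₁] [IsProbabilityMeasure ν₂]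
    (h₁ : ∀ ψ : C(UnitAddCircle, ℝ), ∫ x, markovOp S w circleAct ψ x ∂ν₁ = ∫ x, ψ x ∂ν₁)
    (h₂ : ∀ ψ : C(UnitAddCircle, ℝ), ∫ x, markovOp S w circleAct ψ x ∂ν₂ = ∫ x, ψ x ∂ν₂) :
    ν₁ = ν₂ := by
  choose F hF using fun g : Γ => hΓ g.2
  let D : ℝ → ℝ := fun t => liftCdf ν₁ t - liftCdf ν₂ t
  -- Each distribution function grows by n over n periods; the growth cancels in the difference,
  -- which therefore descends to the circle.
  have hDper : ∀ (t : ℝ) (n : ℤ), D (t + n) = D t := fun t n => by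
    simp only [D, liftCdf_add_intCast]; ring
  have hDcont : Continuous D :=
    (continuous_liftCdf ν₁ (measureReal_singleton_eq_zero hS hinv h₁)).sub
      (continuous_liftCdf ν₂ (measureReal_singleton_eq_zero hS hinv h₂))
  have hDcoe : ∀ t : ℝ, D (circleRep (t : UnitAddCircle)) = D t := fun t => by
    obtain ⟨n, hn⟩ := UnitAddCircle.coe_eq_coe_iff.1 (coe_circleRep (t : UnitAddCircle))
    rw [hn, hDper]
  let G : C(UnitAddCircle, ℝ) := ⟨fun x => D (circleRep x),
    UnitAddCircle.continuous_of_comp_coe (by simpa only [hDcoe] using hDcont)⟩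
  have hGcoe : ∀ t : ℝ, G (t : UnitAddCircle) = D t := hDcoe
  have hsumD : ∀ t, D t - D 0 = ∑ g ∈ S, w g * D (F g t) - ∑ g ∈ S, w g * D (F g 0) := by
    intro t
    have e₁ := liftCdf_sub_eq_sum hS h₁ hF t
    have e₂ := liftCdf_sub_eq_sum hS h₂ hF t
    simp only [mul_sub, Finset.sum_sub_distrib, D] at e₁ e₂ ⊢
    linarith
  have hconst := eq_const_of_markovOp_eq hΓ hS.pos hS.sum_eq hS.closure_eq hinv G
    (D 0 - ∑ g ∈ S, w g * D (F g 0)) (fun x => by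
      obtain ⟨t, rfl⟩ := UnitAddCircle.exists_coe x
      have : ∀ g : Γ, G ((g : CircleHomeo) (t : UnitAddCircle)) = D (F g t) := fun g => by
        rw [(hF g).lifts, hGcoe]
      simp only [this, hGcoe]
      linarith [hsumD t])
  refine eq_of_liftCdf_eq fun t => ?_
  have := hconst (t : UnitAddCircle) ((0 : ℝ) : UnitAddCircle)
  rwa [hGcoe, hGcoe] at this

end Uniqueness

/-! ### Entropy and the sign of the Lyapunov exponent -/

theorem Continuous.integrable_circle {f : UnitAddCircle → ℝ} (hf : Continuous f)
    (m : Measure UnitAddCircle) [IsFiniteMeasure m] : Integrable f m :=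
  ContinuousMap.integrable_of_isFiniteMeasure ⟨f, hf⟩ m

instance UnitAddCircle.isProbabilityMeasure_volume :
    IsProbabilityMeasure (volume : Measure UnitAddCircle) :=
  ⟨UnitAddCircle.measure_univ⟩

section Entropy

variable {Γ : Subgroup CircleHomeo}

/-- The density of the image under `g` of the measure of density `ρ`. -/
noncomputable def pushDensity (hΓ : Γ ≤ circleDiffOne) (g : Γ) (ρ : C(UnitAddCircle, ℝ)) :
    C(UnitAddCircle, ℝ) :=
  ⟨fun y => ρ (((g⁻¹ : Γ) : CircleHomeo) y) * circleDeriv ((g⁻¹ : Γ) : CircleHomeo) y,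
    (ρ.continuous.comp ((g⁻¹ : Γ) : CircleHomeo).continuous).mul
      (continuous_circleDeriv (hΓ (g⁻¹).2))⟩

/-- The logarithm of the derivative of `g`. -/
noncomputable def logCircleDeriv (hΓ : Γ ≤ circleDiffOne) (g : Γ) : C(UnitAddCircle, ℝ) :=
  ⟨fun x => Real.log (circleDeriv (g : CircleHomeo) x),
    (continuous_circleDeriv (hΓ g.2)).log fun x => (circleDeriv_pos (hΓ g.2) x).ne'⟩

variable (hΓ : Γ ≤ circleDiffOne)

theorem logCircleDeriv_apply (g : Γ) (x : UnitAddCircle) :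
    logCircleDeriv hΓ g x = Real.log (circleDeriv (g : CircleHomeo) x) := rfl

theorem pushDensity_pos (g : Γ) {ρ : C(UnitAddCircle, ℝ)} (hρ : ∀ x, 0 < ρ x)
    (y : UnitAddCircle) : 0 < pushDensity hΓ g ρ y :=
  mul_pos (hρ _) (circleDeriv_pos (hΓ (g⁻¹).2) y)

theorem pushDensity_apply_act (g : Γ) (ρ : C(UnitAddCircle, ℝ)) (x : UnitAddCircle) :
    pushDensity hΓ g ρ ((g : CircleHomeo) x) * circleDeriv (g : CircleHomeo) x = ρ x := by
  have h1 : ((g⁻¹ : Γ) : CircleHomeo) ((g : CircleHomeo) x) = x :=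
    (g : CircleHomeo).symm_apply_apply x
  have h2 : circleDeriv ((g⁻¹ : Γ) : CircleHomeo) ((g : CircleHomeo) x) *
      circleDeriv (g : CircleHomeo) x = 1 := circleDeriv_inv_mul (hΓ g.2) x
  change ρ (((g⁻¹ : Γ) : CircleHomeo) ((g : CircleHomeo) x)) * _ * _ = _
  rw [h1, mul_assoc, h2, mul_one]

theorem integral_mul_pushDensity (g : Γ) (ρ : C(UnitAddCircle, ℝ)) {φ : UnitAddCircle → ℝ}
    (hφ : Continuous φ) :
    ∫ y, φ y * pushDensity hΓ g ρ y = ∫ x, φ ((g : CircleHomeo) x) * ρ x := by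
  have h := integral_comp_mul_circleDeriv (hΓ (g⁻¹).2)
    ⟨fun x => φ ((g : CircleHomeo) x) * ρ x,
      (hφ.comp (g : CircleHomeo).continuous).mul ρ.continuous⟩
  rw [ContinuousMap.coe_mk] at h
  rw [← h]
  congr 1
  ext y
  have h1 : (g : CircleHomeo) (((g⁻¹ : Γ) : CircleHomeo) y) = y :=
    (g : CircleHomeo).apply_symm_apply y
  change φ y * (_ * _) = φ ((g : CircleHomeo) (((g⁻¹ : Γ) : CircleHomeo) y)) * _ * _
  rw [h1, mul_assoc]

/-- Variational lower bound for the entropy of an image measure. -/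
theorem entropy_push_ge (g : Γ) {ρ σ : C(UnitAddCircle, ℝ)} (hρ : ∀ x, 0 < ρ x)
    (hσ : ∀ x, 0 < σ x) (ψ : C(UnitAddCircle, ℝ)) :
    (∫ x, Real.log (σ x) * pushDensity hΓ g ρ x) + (∫ x, ψ ((g : CircleHomeo) x) * ρ x)
      - (∫ x, Real.exp (ψ x) * σ x) + ∫ x, ρ x ≤
    (∫ x, Real.log (ρ x) * ρ x) - ∫ x, logCircleDeriv hΓ g x * ρ x := by
  set q := pushDensity hΓ g ρ with hq
  have hqpos : ∀ y, 0 < q y := pushDensity_pos hΓ g hρ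
  have cq : Continuous fun y => Real.log (q y) := q.continuous.log fun y => (hqpos y).ne'
  have cσ : Continuous fun y => Real.log (σ y) := σ.continuous.log fun y => (hσ y).ne'
  have cρ : Continuous fun y => Real.log (ρ y) := ρ.continuous.log fun y => (hρ y).ne'
  have cexp : Continuous fun y => Real.exp (ψ y) := ψ.continuous.rexp
  have h1 : ∫ y, Real.log (q y) * q y =
      (∫ x, Real.log (ρ x) * ρ x) - ∫ x, logCircleDeriv hΓ g x * ρ x := by
    have i1 : Integrable (fun x => Real.log (ρ x) * ρ x) :=
      (cρ.mul ρ.continuous).integrable_circle _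
    have i2 : Integrable (fun x => logCircleDeriv hΓ g x * ρ x) :=
      ((logCircleDeriv hΓ g).continuous.mul ρ.continuous).integrable_circle _
    rw [hq, integral_mul_pushDensity hΓ g ρ cq, ← integral_sub i1 i2]
    congr 1
    ext x
    rw [← sub_mul, logCircleDeriv_apply, ← Real.log_div (hρ x).ne' (circleDeriv_pos (hΓ g.2) x).ne',
      ← pushDensity_apply_act hΓ g ρ x, mul_div_cancel_right₀ _ (circleDeriv_pos (hΓ g.2) x).ne']
  have h2 : ∫ x, ψ ((g : CircleHomeo) x) * ρ x = ∫ y, ψ y * q y :=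
    (integral_mul_pushDensity hΓ g ρ ψ.continuous).symm
  have h3 : ∫ x, ρ x = ∫ y, q y := by
    have := integral_mul_pushDensity hΓ g ρ (continuous_const (y := (1 : ℝ)))
    simpa only [one_mul] using this.symm
  have i1 : Integrable (fun y => Real.log (σ y) * q y) :=
    (cσ.mul q.continuous).integrable_circle volume
  have i2 : Integrable (fun y => ψ y * q y) :=
    (ψ.continuous.mul q.continuous).integrable_circle volume
  have i3 : Integrable (fun y => Real.exp (ψ y) * σ y) :=
    (cexp.mul σ.continuous).integrable_circle volume
  have i4 : Integrable (fun y => q y) := q.continuous.integrable_circle volume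
  have i12 : Integrable (fun y => Real.log (σ y) * q y + ψ y * q y) := i1.add i2
  have i123 : Integrable (fun y => Real.log (σ y) * q y + ψ y * q y - Real.exp (ψ y) * σ y) :=
    i12.sub i3
  rw [← h1, h2, h3, ← integral_add i1 i2, ← integral_sub i12 i3, ← integral_add i123 i4]
  refine integral_mono (i123.add i4)
    ((cq.mul q.continuous).integrable_circle volume) fun y => ?_
  -- The pointwise source of the variational bound for relative entropy: log r ≤ r - 1 at r = exp(ψ)
  -- σ / q, multiplied by q.
  have hr : 0 < Real.exp (ψ y) * σ y / q y := by
    have := hσ y; have := hqpos y; positivity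
  have hlog := Real.log_le_sub_one_of_pos hr
  rw [Real.log_div (mul_pos (Real.exp_pos _) (hσ y)).ne' (hqpos y).ne',
    Real.log_mul (Real.exp_pos _).ne' (hσ y).ne', Real.log_exp] at hlog
  have h4 := mul_le_mul_of_nonneg_right hlog (hqpos y).le
  have h5 : (Real.exp (ψ y) * σ y / q y - 1) * q y = Real.exp (ψ y) * σ y - q y := by
    rw [sub_mul, one_mul, div_mul_cancel₀ _ (hqpos y).ne']
  rw [h5] at h4
  linarith

/-- The transfer operator on densities. -/
noncomputable def transferOp (S : Finset Γ) (w : Γ → ℝ) (ρ : C(UnitAddCircle, ℝ)) :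
    C(UnitAddCircle, ℝ) :=
  ∑ g ∈ S, w g • pushDensity hΓ g ρ

variable {S : Finset Γ} {w : Γ → ℝ}

theorem transferOp_apply (ρ : C(UnitAddCircle, ℝ)) (x : UnitAddCircle) :
    transferOp hΓ S w ρ x = ∑ g ∈ S, w g * pushDensity hΓ g ρ x := by
  simp [transferOp, ContinuousMap.sum_apply]

theorem transferOp_pos (hpos : ∀ g ∈ S, 0 < w g) (hsum : ∑ g ∈ S, w g = 1)
    {ρ : C(UnitAddCircle, ℝ)} (hρ : ∀ x, 0 < ρ x) (x : UnitAddCircle) :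
    0 < transferOp hΓ S w ρ x := by
  rw [transferOp_apply]
  refine Finset.sum_pos (fun g hg => mul_pos (hpos g hg) (pushDensity_pos hΓ g hρ x)) ?_
  rw [Finset.nonempty_iff_ne_empty]
  rintro rfl
  simp at hsum

theorem integral_mul_transferOp (ρ φ : C(UnitAddCircle, ℝ)) :
    ∫ x, φ x * transferOp hΓ S w ρ x = ∫ x, markovOp S w circleAct φ x * ρ x := by
  simp only [transferOp_apply, markovOp_apply, Finset.mul_sum, Finset.sum_mul]
  rw [integral_finsetSum, integral_finsetSum]
  · refine Finset.sum_congr rfl fun g _ => ?_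
    have h := integral_mul_pushDensity hΓ g ρ φ.continuous
    simp only [mul_left_comm _ (w g), mul_assoc]
    rw [integral_const_mul, integral_const_mul, h]
    rfl
  · exact fun g _ => ((continuous_const.mul ((φ.comp (circleAct g)).continuous)).mul
      ρ.continuous).integrable_circle _
  · exact fun g _ => (φ.continuous.mul
      (continuous_const.mul (pushDensity hΓ g ρ).continuous)).integrable_circle _

theorem integral_mul_iterate_transferOp (φ : C(UnitAddCircle, ℝ)) (k : ℕ) :
    ∫ x, φ x * ((transferOp hΓ S w)^[k] 1) x = ∫ x, (markovOp S w circleAct ^ k) φ x := by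
  induction k generalizing φ with
  | zero => simp
  | succ k ih =>
    rw [Function.iterate_succ_apply', integral_mul_transferOp, ih, pow_succ,
      Module.End.mul_apply]

/-- The mean logarithmic derivative `x ↦ ∑ g, w g log g'(x)`. -/
noncomputable def meanLogDeriv (S : Finset Γ) (w : Γ → ℝ) : C(UnitAddCircle, ℝ) :=
  ∑ g ∈ S, w g • logCircleDeriv hΓ g

theorem meanLogDeriv_apply (x : UnitAddCircle) :
    meanLogDeriv hΓ S w x = ∑ g ∈ S, w g * logCircleDeriv hΓ g x := by
  simp [meanLogDeriv, ContinuousMap.sum_apply]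

/-- Averaging `entropy_push_ge` over g, with σ the averaged density, makes the terms in log σ add up
to the entropy of σ. The entropy drop then dominates the mean log-derivative plus the test term for
g₀. -/
theorem entropy_transferOp_le (hpos : ∀ g ∈ S, 0 < w g) (hsum : ∑ g ∈ S, w g = 1)
    {ρ : C(UnitAddCircle, ℝ)} (hρ : ∀ x, 0 < ρ x) {g₀ : Γ} (hg₀ : g₀ ∈ S)
    (ψ : C(UnitAddCircle, ℝ)) :
    (∫ x, (meanLogDeriv hΓ S w x + w g₀ * ψ ((g₀ : CircleHomeo) x)) * ρ x)
      - (∫ x, w g₀ * (Real.exp (ψ x) - 1) * transferOp hΓ S w ρ x) ≤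
    (∫ x, Real.log (ρ x) * ρ x) -
      ∫ x, Real.log (transferOp hΓ S w ρ x) * transferOp hΓ S w ρ x := by
  classical
  set σ := transferOp hΓ S w ρ with hσdef
  have hσ : ∀ x, 0 < σ x := transferOp_pos hΓ hpos hsum hρ
  have cσ : Continuous fun y => Real.log (σ y) := σ.continuous.log fun y => (hσ y).ne'
  have cexp : Continuous fun y => Real.exp (ψ y) := ψ.continuous.rexp
  have hmass : ∫ x, σ x = ∫ x, ρ x := by
    have := integral_mul_transferOp hΓ (S := S) (w := w) ρ 1
    have h1 : markovOp S w circleAct (1 : C(UnitAddCircle, ℝ)) = 1 := by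
      ext x; simp [markovOp_apply, hsum]
    rw [h1] at this
    simpa using this
  -- The test function is spent on g₀ alone; the other elements use ψ = 0, which amounts to
  -- nonnegativity of relative entropy.
  have hall : ∀ g ∈ S, w g * ((∫ x, Real.log (σ x) * pushDensity hΓ g ρ x) +
      (if g = g₀ then (∫ x, ψ ((g₀ : CircleHomeo) x) * ρ x)
        - (∫ x, (Real.exp (ψ x) - 1) * σ x) else 0)) ≤
      w g * ((∫ x, Real.log (ρ x) * ρ x) - ∫ x, logCircleDeriv hΓ g x * ρ x) := by
    intro g hg
    refine mul_le_mul_of_nonneg_left ?_ (hpos g hg).le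
    split_ifs with h
    · subst h
      refine le_trans (le_of_eq ?_) (entropy_push_ge hΓ g hρ hσ ψ)
      simp only [sub_mul, one_mul]
      have i1 : Integrable (fun y => Real.exp (ψ y) * σ y) :=
        (cexp.mul σ.continuous).integrable_circle volume
      rw [integral_sub i1 (σ.continuous.integrable_circle _), hmass]
      ring
    · refine le_trans (le_of_eq ?_) (entropy_push_ge hΓ g hρ hσ 0)
      simp [hmass]
  have h1 := Finset.sum_le_sum hall
  simp only [mul_add, mul_sub, Finset.sum_add_distrib, Finset.sum_sub_distrib, ← Finset.sum_mul,
    hsum, one_mul, mul_ite, mul_zero, Finset.sum_ite_eq', hg₀, if_true] at h1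
  have h2 : ∑ g ∈ S, w g * ∫ x, Real.log (σ x) * pushDensity hΓ g ρ x =
      ∫ x, Real.log (σ x) * σ x := by
    have hσx : ∀ x, Real.log (σ x) * σ x =
        ∑ g ∈ S, Real.log (σ x) * (w g * pushDensity hΓ g ρ x) := fun x => by
      rw [← Finset.mul_sum, ← transferOp_apply]
    simp only [hσx]
    rw [integral_finsetSum]
    · refine Finset.sum_congr rfl fun g _ => ?_
      simp only [mul_left_comm _ (w g)]
      rw [integral_const_mul]
    · exact fun g _ => (cσ.mul
        (continuous_const.mul (pushDensity hΓ g ρ).continuous)).integrable_circle _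
  have h3 : ∑ g ∈ S, w g * ∫ x, logCircleDeriv hΓ g x * ρ x = ∫ x, meanLogDeriv hΓ S w x * ρ x := by
    simp only [meanLogDeriv_apply, Finset.sum_mul]
    rw [integral_finsetSum]
    · refine Finset.sum_congr rfl fun g _ => ?_
      simp only [mul_assoc]
      rw [integral_const_mul]
    · exact fun g _ => ((continuous_const.mul (logCircleDeriv hΓ g).continuous).mul
        ρ.continuous).integrable_circle _
  rw [h2, h3] at h1
  simp only [add_mul, mul_assoc]
  have i1 : Integrable (fun x => meanLogDeriv hΓ S w x * ρ x) :=
    ((meanLogDeriv hΓ S w).continuous.mul ρ.continuous).integrable_circle _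
  have i2 : Integrable (fun x => w g₀ * (ψ ((g₀ : CircleHomeo) x) * ρ x)) :=
    (continuous_const.mul (((ψ.comp (circleAct g₀)).continuous).mul
      ρ.continuous)).integrable_circle _
  rw [integral_add i1 i2, integral_const_mul, integral_const_mul]
  linarith

theorem iterate_transferOp_pos (hpos : ∀ g ∈ S, 0 < w g) (hsum : ∑ g ∈ S, w g = 1) (k : ℕ)
    (x : UnitAddCircle) : 0 < ((transferOp hΓ S w)^[k] 1) x := by
  induction k generalizing x with
  | zero => simp
  | succ k ih =>
    rw [Function.iterate_succ_apply']
    exact transferOp_pos hΓ hpos hsum ih x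

/-- The entropy drops telescope along the iterates of the density 1, from entropy 0 to an entropy
that is nonnegative. -/
theorem integral_cesaroOp_meanLogDeriv_le (hpos : ∀ g ∈ S, 0 < w g) (hsum : ∑ g ∈ S, w g = 1)
    {g₀ : Γ} (hg₀ : g₀ ∈ S) {ψ η : C(UnitAddCircle, ℝ)} (hη : ∀ x, η x = Real.exp (ψ x) - 1)
    (N : ℕ) :
    ∫ x, cesaroOp (markovOp S w circleAct) N (meanLogDeriv hΓ S w
      + w g₀ • ψ.comp (circleAct g₀) - w g₀ • markovOp S w circleAct η) x ≤ 0 := by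
  set P := markovOp S w (circleAct (Γ := Γ)) with hP
  set ρ : ℕ → C(UnitAddCircle, ℝ) := fun k => (transferOp hΓ S w)^[k] 1 with hρdef
  have hρ : ∀ k x, 0 < ρ k x := iterate_transferOp_pos hΓ hpos hsum
  have hρsucc : ∀ k, ρ (k + 1) = transferOp hΓ S w (ρ k) := fun k =>
    Function.iterate_succ_apply' _ _ _
  have hint : ∀ (φ : C(UnitAddCircle, ℝ)) k, ∫ x, φ x * ρ k x = ∫ x, (P ^ k) φ x :=
    fun φ k => integral_mul_iterate_transferOp hΓ φ k
  set H : ℕ → ℝ := fun k => ∫ x, Real.log (ρ k x) * ρ k x with hH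
  have hstep : ∀ k, ∫ x, (P ^ k) (meanLogDeriv hΓ S w
      + w g₀ • ψ.comp (circleAct g₀) - w g₀ • P η) x ≤ H k - H (k + 1) := by
    intro k
    have h1 := entropy_transferOp_le hΓ hpos hsum (hρ k) hg₀ ψ
    rw [← hρsucc] at h1
    refine le_trans (le_of_eq ?_) h1
    -- The exponential term is integrated against the density after the step, which costs one extra
    -- P. Stationarity removes it in the limit.
    have h2 : ∫ x, w g₀ * (Real.exp (ψ x) - 1) * ρ (k + 1) x =
        ∫ x, (P ^ k) (w g₀ • P η) x := by
      rw [← map_smul P, ← Module.End.mul_apply, ← pow_succ, ← hint]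
      simp [hη]
    have h3 : ∫ x, (meanLogDeriv hΓ S w x + w g₀ * ψ ((g₀ : CircleHomeo) x)) * ρ k x =
        ∫ x, (P ^ k) (meanLogDeriv hΓ S w + w g₀ • ψ.comp (circleAct g₀)) x := by
      rw [← hint]
      rfl
    rw [h2, h3, map_sub]
    simp only [ContinuousMap.sub_apply]
    exact integral_sub (ContinuousMap.integrable_of_isFiniteMeasure _ _)
      (ContinuousMap.integrable_of_isFiniteMeasure _ _)
  rw [integral_cesaroOp, ← Finset.mul_sum]
  refine mul_nonpos_of_nonneg_of_nonpos (by positivity) ?_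
  refine (Finset.sum_le_sum fun k _ => hstep k).trans ?_
  rw [Finset.sum_range_sub']
  have hH0 : H 0 = 0 := by simp [hH, hρdef]
  have hHN : 0 ≤ H N := by
    have hmass : ∫ x, ρ N x = 1 := by
      have h1 := hint 1 N
      have h2 : ∀ k, (P ^ k) (1 : C(UnitAddCircle, ℝ)) = 1 := by
        intro k
        induction k with
        | zero => simp
        | succ k ih =>
          rw [pow_succ, Module.End.mul_apply]
          have : P (1 : C(UnitAddCircle, ℝ)) = 1 := by
            ext x; simp [hP, markovOp_apply, hsum]
          rw [this, ih]
      rw [h2] at h1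
      simpa using h1
    -- From ρ log ρ ≥ ρ - 1; the left side vanishes because ρ has mass 1.
    have h3 : ∫ x, (ρ N x - 1) ≤ H N := by
      refine integral_mono (((ρ N).continuous.sub continuous_const).integrable_circle _)
        ((((ρ N).continuous.log fun y => (hρ N y).ne').mul
          (ρ N).continuous).integrable_circle _) fun x => ?_
      have h4 := Real.one_sub_inv_le_log_of_pos (hρ N x)
      have h5 := mul_le_mul_of_nonneg_right h4 (hρ N x).le
      rwa [sub_mul, one_mul, inv_mul_cancel₀ (hρ N x).ne'] at h5
    rw [integral_sub ((ρ N).continuous.integrable_circle _) (integrable_const _), hmass] at h3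
    simpa using h3
  linarith

/-- There is a stationary measure satisfying the entropy inequality. -/
theorem exists_stationary_entropy_le (hpos : ∀ g ∈ S, 0 < w g) (hsum : ∑ g ∈ S, w g = 1) :
    ∃ ν : Measure UnitAddCircle, IsProbabilityMeasure ν ∧
      (∀ ψ : C(UnitAddCircle, ℝ), ∫ x, markovOp S w circleAct ψ x ∂ν = ∫ x, ψ x ∂ν) ∧
      ∀ g₀ ∈ S, ∀ ψ : C(UnitAddCircle, ℝ), (∫ x, meanLogDeriv hΓ S w x ∂ν)
        + w g₀ * (∫ x, ψ ((g₀ : CircleHomeo) x) ∂ν)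
        - w g₀ * (∫ x, (Real.exp (ψ x) - 1) ∂ν) ≤ 0 := by
  have hprob : IsProbabilityMeasure (volume : Measure UnitAddCircle) := inferInstance
  obtain ⟨ν, hν, hst, hlim⟩ := exists_stationary_tendsto (h := circleAct (Γ := Γ))
    (fun g hg => (hpos g hg).le) hsum (fun _ => (volume : Measure UnitAddCircle))
    (fun _ => hprob) id tendsto_id (Filter.hyperfilter ℕ)
    (by rw [← Nat.cofinite_eq_atTop]; exact Filter.hyperfilter_le_cofinite)
  refine ⟨ν, hν, hst, fun g₀ hg₀ ψ => ?_⟩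
  let η : C(UnitAddCircle, ℝ) := ⟨fun x => Real.exp (ψ x) - 1,
    ψ.continuous.rexp.sub continuous_const⟩
  have h1 := le_of_tendsto (hlim (meanLogDeriv hΓ S w
      + w g₀ • ψ.comp (circleAct g₀) - w g₀ • markovOp S w circleAct η))
    (Eventually.of_forall fun N =>
      integral_cesaroOp_meanLogDeriv_le hΓ hpos hsum hg₀ (fun x => rfl) _)
  simp only [ContinuousMap.sub_apply, ContinuousMap.add_apply, ContinuousMap.smul_apply,
    smul_eq_mul, ContinuousMap.comp_apply] at h1
  rw [integral_sub, integral_add, integral_const_mul, integral_const_mul, hst η] at h1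
  · exact h1
  · exact ContinuousMap.integrable_of_isFiniteMeasure _ _
  · exact (continuous_const.mul (ψ.comp (circleAct g₀)).continuous).integrable_circle _
  · exact ((meanLogDeriv hΓ S w).continuous.add
      (continuous_const.mul (ψ.comp (circleAct g₀)).continuous)).integrable_circle _
  · exact (continuous_const.mul (markovOp S w circleAct η).continuous).integrable_circle _

/-- Linearization: apply the hypothesis to tψ, divide by t > 0 and let t tend to 0. The exponential
contributes a quadratic error, valid once t‖ψ‖ ≤ 1. -/
theorem integral_comp_le_of_forall_exp {ν : Measure UnitAddCircle} [IsProbabilityMeasure ν]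
    {g : CircleHomeo}
    (h : ∀ ψ : C(UnitAddCircle, ℝ), ∫ x, ψ (g x) ∂ν ≤ ∫ x, (Real.exp (ψ x) - 1) ∂ν)
    (ψ : C(UnitAddCircle, ℝ)) : ∫ x, ψ (g x) ∂ν ≤ ∫ x, ψ x ∂ν := by
  have key : ∀ t : ℝ, 0 < t → t * ‖ψ‖ ≤ 1 →
      ∫ x, ψ (g x) ∂ν ≤ (∫ x, ψ x ∂ν) + t * ‖ψ‖ ^ 2 := by
    intro t ht ht1
    have h1 := h (t • ψ)
    simp only [ContinuousMap.smul_apply, smul_eq_mul] at h1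
    rw [integral_const_mul] at h1
    have h2 : ∫ x, (Real.exp (t * ψ x) - 1) ∂ν ≤ ∫ x, (t * ψ x + (t * ‖ψ‖) ^ 2) ∂ν := by
      refine integral_mono
        (((continuous_const.mul ψ.continuous).rexp.sub continuous_const).integrable_circle _)
        (((continuous_const.mul ψ.continuous).add continuous_const).integrable_circle _)
        fun x => ?_
      have h3 : |t * ψ x| ≤ t * ‖ψ‖ := by
        rw [abs_mul, abs_of_pos ht]
        exact mul_le_mul_of_nonneg_left (ψ.norm_coe_le_norm x) ht.le
      have h4 := (abs_le.1 (Real.abs_exp_sub_one_sub_id_le (h3.trans ht1))).2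
      have h5 : (t * ψ x) ^ 2 ≤ (t * ‖ψ‖) ^ 2 := sq_le_sq.2 (h3.trans (le_abs_self _))
      simp only
      linarith
    have i1 : Integrable (fun x => t * ψ x) ν :=
      (continuous_const.mul ψ.continuous).integrable_circle _
    rw [integral_add i1 (integrable_const _), integral_const_mul] at h2
    simp only [integral_const, probReal_univ, one_smul] at h2
    have h6 : t * ∫ x, ψ (g x) ∂ν ≤ t * ((∫ x, ψ x ∂ν) + t * ‖ψ‖ ^ 2) := by
      linarith [h1.trans h2, mul_pow t ‖ψ‖ 2, pow_two t]
    exact le_of_mul_le_mul_left h6 ht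
  have hlim : Tendsto (fun t : ℝ => (∫ x, ψ x ∂ν) + t * ‖ψ‖ ^ 2) (𝓝[>] 0)
      (𝓝 ((∫ x, ψ x ∂ν) + 0 * ‖ψ‖ ^ 2)) :=
    ((continuous_const.add (continuous_id.mul continuous_const)).tendsto 0).mono_left
      nhdsWithin_le_nhds
  rw [zero_mul, add_zero] at hlim
  refine ge_of_tendsto hlim ?_
  have hsmall : ∀ᶠ t : ℝ in 𝓝[>] 0, t * ‖ψ‖ < 1 := by
    have : Tendsto (fun t : ℝ => t * ‖ψ‖) (𝓝[>] 0) (𝓝 (0 * ‖ψ‖)) :=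
      ((continuous_id.mul continuous_const).tendsto 0).mono_left nhdsWithin_le_nhds
    rw [zero_mul] at this
    exact this.eventually_lt_const one_pos
  filter_upwards [hsmall, self_mem_nhdsWithin] with t ht ht0
  exact key t ht0 ht.le

/-- The linearized inequality holds for ψ and for -ψ, hence is an equality. -/
theorem map_eq_of_forall_exp {ν : Measure UnitAddCircle} [IsProbabilityMeasure ν]
    {g : CircleHomeo}
    (h : ∀ ψ : C(UnitAddCircle, ℝ), ∫ x, ψ (g x) ∂ν ≤ ∫ x, (Real.exp (ψ x) - 1) ∂ν) :
    ν.map g = ν := by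
  have : IsProbabilityMeasure (ν.map g) :=
    Measure.isProbabilityMeasure_map g.continuous.measurable.aemeasurable
  refine ext_of_forall_integral_eq_of_IsFiniteMeasure fun ψ => ?_
  rw [integral_map g.continuous.measurable.aemeasurable ψ.continuous.aestronglyMeasurable]
  have h1 := integral_comp_le_of_forall_exp h ψ.toContinuousMap
  have h2 := integral_comp_le_of_forall_exp h (-ψ.toContinuousMap)
  simp only [ContinuousMap.neg_apply, integral_neg, neg_le_neg_iff] at h2
  exact le_antisymm h1 h2

/-- A random walk without invariant measure has a stationary measure with negative mean
logarithmic derivative. -/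
theorem exists_stationary_integral_meanLogDeriv_neg (hpos : ∀ g ∈ S, 0 < w g)
    (hsum : ∑ g ∈ S, w g = 1) (hgen : Subsemigroup.closure (S : Set Γ) = ⊤)
    (hinv : ¬ ∃ ν : Measure UnitAddCircle, IsProbabilityMeasure ν ∧ PreservesMeasure Γ ν) :
    ∃ ν : Measure UnitAddCircle, IsProbabilityMeasure ν ∧
      (∀ ψ : C(UnitAddCircle, ℝ), ∫ x, markovOp S w circleAct ψ x ∂ν = ∫ x, ψ x ∂ν) ∧
      ∫ x, meanLogDeriv hΓ S w x ∂ν < 0 := by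
  obtain ⟨ν, hν, hst, hent⟩ := exists_stationary_entropy_le hΓ hpos hsum
  refine ⟨ν, hν, hst, ?_⟩
  by_contra! hnn
  refine hinv ⟨ν, hν, fun g hg => ?_⟩
  have hmem : (⟨g, hg⟩ : Γ) ∈ Subsemigroup.closure (S : Set Γ) := by rw [hgen]; trivial
  have key : ∀ g ∈ Subsemigroup.closure (S : Set Γ), ν.map (g : CircleHomeo) = ν := by
    intro g hg
    induction hg using Subsemigroup.closure_induction with
    | mem g hg =>
      refine map_eq_of_forall_exp fun ψ => ?_
      have h1 := hent g hg ψ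
      have h2 : w g * (∫ x, ψ ((g : CircleHomeo) x) ∂ν) ≤
          w g * (∫ x, (Real.exp (ψ x) - 1) ∂ν) := by linarith
      exact le_of_mul_le_mul_left h2 (hpos g hg)
    | mul g₁ g₂ _ _ h₁ h₂ =>
      have : (((g₁ * g₂ : Γ) : CircleHomeo) : UnitAddCircle → UnitAddCircle) =
          (g₁ : CircleHomeo) ∘ (g₂ : CircleHomeo) := rfl
      rw [this, ← Measure.map_map (g₁ : CircleHomeo).continuous.measurable
        (g₂ : CircleHomeo).continuous.measurable, h₂, h₁]
  exact key _ hmem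

end Entropy

/-! ### A strong law of large numbers for bounded orthogonal sequences -/

section OrthogonalLLN

variable {Ω : Type*} [MeasurableSpace Ω] {Q : Measure Ω} [IsProbabilityMeasure Q]
  {D : ℕ → Ω → ℝ} {C : ℝ}

theorem abs_sum_range_le (hC : ∀ i p, |D i p| ≤ C) (p : Ω) (n : ℕ) :
    |∑ i ∈ Finset.range n, D i p| ≤ n * C := by
  refine (Finset.abs_sum_le_sum_abs _ _).trans ?_
  refine (Finset.sum_le_sum fun i _ => hC i p).trans ?_
  simp

/-- Orthogonality kills the cross terms when the square is expanded, so the second moment grows only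
linearly. -/
theorem integral_sq_sum_range_le (hD : ∀ i, Measurable (D i)) (hC : ∀ i p, |D i p| ≤ C)
    (horth : ∀ i j, i < j → ∫ p, D i p * D j p ∂Q = 0) (n : ℕ) :
    ∫ p, (∑ i ∈ Finset.range n, D i p) ^ 2 ∂Q ≤ n * C ^ 2 := by
  have hint : ∀ i j, Integrable (fun p => D i p * D j p) Q := fun i j =>
    Integrable.of_bound ((hD i).mul (hD j)).aestronglyMeasurable (C * C)
      (Eventually.of_forall fun p => by
        rw [norm_mul]
        exact mul_le_mul (hC i p) (hC j p) (abs_nonneg _) ((abs_nonneg _).trans (hC i p)))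
  induction n with
  | zero => simp
  | succ n ih =>
    have h1 : ∀ p, (∑ i ∈ Finset.range (n + 1), D i p) ^ 2 =
        (∑ i ∈ Finset.range n, D i p) ^ 2 + (2 * ∑ i ∈ Finset.range n, D i p * D n p)
          + D n p * D n p := fun p => by
      rw [Finset.sum_range_succ, ← Finset.sum_mul]; ring
    have i1 : Integrable (fun p => (∑ i ∈ Finset.range n, D i p) ^ 2) Q := by
      have : ∀ p, (∑ i ∈ Finset.range n, D i p) ^ 2 =
          ∑ i ∈ Finset.range n, ∑ j ∈ Finset.range n, D i p * D j p := fun p => by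
        rw [sq, Finset.sum_mul_sum]
      simp only [this]
      exact integrable_finsetSum _ fun i _ => integrable_finsetSum _ fun j _ => hint i j
    have i2 : Integrable (fun p => 2 * ∑ i ∈ Finset.range n, D i p * D n p) Q :=
      (integrable_finsetSum _ fun i _ => hint i n).const_mul 2
    have i12 : Integrable (fun p => (∑ i ∈ Finset.range n, D i p) ^ 2
        + 2 * ∑ i ∈ Finset.range n, D i p * D n p) Q := i1.add i2
    simp only [h1]
    rw [integral_add i12 (hint n n), integral_add i1 i2, integral_const_mul,
      integral_finsetSum _ fun i _ => hint i n,
      Finset.sum_eq_zero fun i hi => horth i n (Finset.mem_range.1 hi)]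
    have h2 : ∫ p, D n p * D n p ∂Q ≤ C ^ 2 := by
      have : ∫ p, D n p * D n p ∂Q ≤ ∫ _, C ^ 2 ∂Q := by
        refine integral_mono (hint n n) (integrable_const _) fun p => ?_
        simp only
        rw [← sq, ← sq_abs]
        exact pow_le_pow_left₀ (abs_nonneg _) (hC n p) 2
      simpa using this
    push_cast
    linarith

/-- Along n = m² the second moments of the averages are at most C² / m², which is summable. The sum
of the squared averages is then finite almost everywhere. -/
theorem ae_tendsto_average_sq_zero (hD : ∀ i, Measurable (D i)) (hC : ∀ i p, |D i p| ≤ C)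
    (horth : ∀ i j, i < j → ∫ p, D i p * D j p ∂Q = 0) :
    ∀ᵐ p ∂Q, Tendsto (fun m : ℕ => (∑ i ∈ Finset.range (m ^ 2), D i p) / ((m ^ 2 : ℕ) : ℝ))
      atTop (𝓝 0) := by
  set T : ℕ → Ω → ℝ := fun m p => (∑ i ∈ Finset.range (m ^ 2), D i p) / ((m ^ 2 : ℕ) : ℝ) with hT
  have hTm : ∀ m, Measurable (T m) := fun m =>
    (Finset.measurable_fun_sum _ fun i _ => hD i).div_const _
  have hTsq : ∀ m, ∫ p, T m p ^ 2 ∂Q ≤ C ^ 2 * (1 / (m : ℝ) ^ 2) := by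
    intro m
    rcases Nat.eq_zero_or_pos m with rfl | hm
    · simp [hT]
    have hm' : (0 : ℝ) < m := by exact_mod_cast hm
    simp only [hT, div_pow]
    rw [integral_div]
    have := integral_sq_sum_range_le hD hC horth (m ^ 2)
    push_cast at this ⊢
    rw [div_le_iff₀ (by positivity)]
    refine this.trans (le_of_eq ?_)
    field_simp
  have hTbd : ∀ m p, |T m p| ≤ C := fun m p => by
    have hC0 : 0 ≤ C := (abs_nonneg _).trans (hC 0 p)
    simp only [hT]
    rw [abs_div, Nat.abs_cast]
    exact div_le_of_le_mul₀ (by positivity) hC0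
      ((abs_sum_range_le hC p _).trans_eq (mul_comm _ _))
  have hTint : ∀ m, Integrable (fun p => T m p ^ 2) Q := fun m =>
    Integrable.of_bound ((hTm m).pow_const 2).aestronglyMeasurable (C ^ 2)
      (Eventually.of_forall fun p => by
        rw [norm_pow]
        exact pow_le_pow_left₀ (norm_nonneg _) (hTbd m p) 2)
  have hlint : ∫⁻ p, ∑' m, ENNReal.ofReal (T m p ^ 2) ∂Q ≠ ⊤ := by
    rw [lintegral_tsum fun m => ((hTm m).pow_const 2).ennreal_ofReal.aemeasurable]
    have hsum : Summable fun m : ℕ => C ^ 2 * (1 / (m : ℝ) ^ 2) :=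
      (Real.summable_one_div_nat_pow.2 one_lt_two).mul_left _
    refine ne_top_of_le_ne_top hsum.tsum_ofReal_ne_top (ENNReal.tsum_le_tsum fun m => ?_)
    rw [← ofReal_integral_eq_lintegral_ofReal (hTint m) (Eventually.of_forall fun p => sq_nonneg _)]
    exact ENNReal.ofReal_le_ofReal (hTsq m)
  filter_upwards [ae_lt_top (Measurable.tsum fun m =>
    ((hTm m).pow_const 2).ennreal_ofReal) hlint] with p hp
  have h1 := ENNReal.tendsto_atTop_zero_of_tsum_ne_top hp.ne
  have h2 : Tendsto (fun m => T m p ^ 2) atTop (𝓝 0) := by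
    have := (ENNReal.tendsto_toReal ENNReal.zero_ne_top).comp h1
    simpa [Function.comp_def, ENNReal.toReal_ofReal, sq_nonneg] using this
  have h3 := h2.sqrt
  simp only [Real.sqrt_sq_eq_abs, Real.sqrt_zero] at h3
  exact (tendsto_zero_iff_abs_tendsto_zero _).2 h3

/-- The averages of a bounded orthogonal sequence converge to zero almost everywhere. -/
theorem ae_tendsto_average_zero (hD : ∀ i, Measurable (D i)) (hC : ∀ i p, |D i p| ≤ C)
    (horth : ∀ i j, i < j → ∫ p, D i p * D j p ∂Q = 0) :
    ∀ᵐ p ∂Q, Tendsto (fun n : ℕ => (∑ i ∈ Finset.range n, D i p) / (n : ℝ)) atTop (𝓝 0) := by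
  filter_upwards [ae_tendsto_average_sq_zero hD hC horth] with p hp
  have hC0 : 0 ≤ C := (abs_nonneg _).trans (hC 0 p)
  have hsqrt : Tendsto Nat.sqrt atTop atTop :=
    tendsto_atTop.2 fun b => (eventually_ge_atTop (b ^ 2)).mono fun n hn => Nat.le_sqrt'.2 hn
  have h1 : Tendsto (fun m : ℕ => |(∑ i ∈ Finset.range (m ^ 2), D i p) / ((m ^ 2 : ℕ) : ℝ)|
      + 2 * C / m) atTop (𝓝 (|0| + 0)) :=
    hp.abs.add (tendsto_const_div_atTop_nhds_zero_nat (2 * C))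
  rw [abs_zero, add_zero] at h1
  refine squeeze_zero_norm' ?_ (h1.comp hsqrt)
  filter_upwards [eventually_ge_atTop 1] with n hn
  -- Compare n with the square m² just below it: at most 2m terms are added, which costs 2mC / m² =
  -- 2C / m.
  set m := Nat.sqrt n with hm
  have hm1 : 1 ≤ m := Nat.le_sqrt'.2 (by simpa using hn)
  have hle : m ^ 2 ≤ n := Nat.sqrt_le' n
  have hlt : n ≤ m ^ 2 + 2 * m := by
    have := Nat.lt_succ_sqrt' n
    rw [← hm, Nat.succ_eq_add_one] at this
    nlinarith
  have hm0 : (0 : ℝ) < m := by exact_mod_cast hm1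
  have hn0 : (0 : ℝ) < n := by exact_mod_cast hn
  have hle' : (m : ℝ) ^ 2 ≤ n := by exact_mod_cast hle
  have hlt' : (n : ℝ) - (m : ℝ) ^ 2 ≤ 2 * m := by
    have : (n : ℝ) ≤ (m : ℝ) ^ 2 + 2 * m := by exact_mod_cast hlt
    linarith
  have hsplit : |∑ i ∈ Finset.range n, D i p| ≤
      |∑ i ∈ Finset.range (m ^ 2), D i p| + 2 * m * C := by
    rw [← Finset.sum_range_add_sum_Ico _ hle]
    refine (abs_add_le _ _).trans (add_le_add_right ?_ _)
    refine (Finset.abs_sum_le_sum_abs _ _).trans ?_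
    refine (Finset.sum_le_sum fun i _ => hC i p).trans ?_
    rw [Finset.sum_const, Nat.card_Ico, nsmul_eq_mul, Nat.cast_sub hle]
    push_cast
    exact mul_le_mul_of_nonneg_right hlt' hC0
  simp only [Function.comp_apply]
  rw [← hm, Real.norm_eq_abs, abs_div, abs_of_pos hn0, abs_div, Nat.abs_cast]
  push_cast
  calc |∑ i ∈ Finset.range n, D i p| / n
      ≤ (|∑ i ∈ Finset.range (m ^ 2), D i p| + 2 * m * C) / (m : ℝ) ^ 2 := by gcongr
    _ = _ := by rw [add_div]; congr 1; field_simp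

end OrthogonalLLN

/-! ### Random compositions and the Lyapunov exponent -/

section RandomWalk

variable {Γ : Subgroup CircleHomeo}

/-- Countability of Γ is what makes the random compositions jointly measurable for the discrete
σ-algebra. -/
theorem countable_of_closure_eq_top {M : Type*} [Monoid M] {S : Set M} (hS : S.Countable)
    (h : Subsemigroup.closure S = ⊤) : Countable M := by
  have := hS.to_subtype
  have hsurj : Function.Surjective fun l : List S => (l.map Subtype.val).prod := by
    intro g
    have hg : g ∈ Subsemigroup.closure S := by rw [h]; trivial
    induction hg using Subsemigroup.closure_induction with
    | mem g hg => exact ⟨[⟨g, hg⟩], by simp⟩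
    | mul g₁ g₂ _ _ h₁ h₂ =>
      obtain ⟨l₁, rfl⟩ := h₁
      obtain ⟨l₂, rfl⟩ := h₂
      exact ⟨l₁ ++ l₂, by simp⟩
  exact hsurj.countable

instance instDiscreteMeasurableSpaceCircleSubgroup : DiscreteMeasurableSpace Γ :=
  ⟨fun _ => trivial⟩

theorem randomComp_congr {ω ω' : ℕ → Γ} {n : ℕ} (h : ∀ k < n, ω k = ω' k) :
    randomComp ω n = randomComp ω' n := by
  induction n with
  | zero => rfl
  | succ n ih =>
    rw [randomComp, randomComp, h n n.lt_succ_self, ih fun k hk => h k (hk.trans n.lt_succ_self)]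

/-- Extend a finite word by the identity. -/
def extendWord {n : ℕ} (r : Finset.range n → Γ) (k : ℕ) : Γ :=
  if h : k ∈ Finset.range n then r ⟨k, h⟩ else 1

theorem randomComp_extendWord (ω : ℕ → Γ) {n j : ℕ} (hj : j ≤ n) :
    randomComp (extendWord fun i : Finset.range n => ω i) j = randomComp ω j :=
  randomComp_congr fun _ hk => dif_pos (Finset.mem_range.2 (hk.trans_le hj))

theorem log_circleDeriv_randomComp (hΓ : Γ ≤ circleDiffOne) (ω : ℕ → Γ) (x : UnitAddCircle)
    (n : ℕ) : Real.log (circleDeriv (randomComp ω n : CircleHomeo) x) =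
      ∑ i ∈ Finset.range n, logCircleDeriv hΓ (ω i) ((randomComp ω i : CircleHomeo) x) := by
  induction n with
  | zero => simp [randomComp, circleDeriv_one]
  | succ n ih =>
    rw [Finset.sum_range_succ, ← ih, randomComp, Subgroup.coe_mul,
      circleDeriv_mul (hΓ (ω n).2) (hΓ (randomComp ω n).2),
      Real.log_mul (circleDeriv_pos (hΓ (ω n).2) _).ne'
        (circleDeriv_pos (hΓ (randomComp ω n).2) _).ne', add_comm, logCircleDeriv_apply]

variable [Countable Γ]

theorem measurable_randomComp (n : ℕ) : Measurable fun ω : ℕ → Γ => randomComp ω n := by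
  have h : (fun ω : ℕ → Γ => randomComp ω n) =
      (fun r : Finset.range n → Γ => randomComp (extendWord r) n) ∘
        fun ω (i : Finset.range n) => ω i := by
    ext1 ω
    exact (randomComp_extendWord ω le_rfl).symm
  rw [h]
  exact (measurable_of_countable _).comp (measurable_pi_lambda _ fun i => measurable_pi_apply _)

theorem measurable_randomComp_eval (D : Γ → C(UnitAddCircle, ℝ)) (j : ℕ) :
    Measurable fun p : (ℕ → Γ) × UnitAddCircle =>
      D (p.1 j) ((randomComp p.1 j : CircleHomeo) p.2) := by
  have h1 : Measurable fun q : (Γ × Γ) × UnitAddCircle => D q.1.1 ((q.1.2 : CircleHomeo) q.2) :=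
    measurable_from_prod_countable_right fun a =>
      ((D a.1).continuous.comp (a.2 : CircleHomeo).continuous).measurable
  exact h1.comp ((((measurable_pi_apply j).comp measurable_fst).prodMk
    ((measurable_randomComp j).comp measurable_fst)).prodMk measurable_snd)

/-- The martingale-difference property: given the first j letters, the letter at index j is fresh,
and D has mean zero over it at every point. -/
theorem integral_randomComp_mul_eq_zero (μ : PMF Γ) {S : Finset Γ}
    {D : Γ → C(UnitAddCircle, ℝ)} (hDS : ∀ g ∉ S, D g = 0)
    (hD0 : ∀ x, ∑ g ∈ S, (μ g).toReal * D g x = 0) {C : ℝ} (hC : ∀ g x, |D g x| ≤ C)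
    (x : UnitAddCircle) {i j : ℕ} (hij : i < j) :
    ∫ ω, D (ω i) ((randomComp ω i : CircleHomeo) x) * D (ω j) ((randomComp ω j : CircleHomeo) x)
      ∂(Measure.infinitePi fun _ : ℕ => μ.toMeasure) = 0 := by
  classical
  set P := Measure.infinitePi fun _ : ℕ => μ.toMeasure with hP
  set R : (ℕ → Γ) → (Finset.range j → Γ) := fun ω k => ω k with hR
  have hRm : Measurable R := measurable_pi_lambda _ fun i => measurable_pi_apply _
  have hind : ProbabilityTheory.IndepFun R (fun ω => ω j) P := by
    have h1 : ProbabilityTheory.iIndepFun (fun (k : ℕ) (ω : ℕ → Γ) => ω k) P :=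
      ProbabilityTheory.iIndepFun_infinitePi (P := fun _ : ℕ => μ.toMeasure)
        (X := fun _ g => g) fun _ => measurable_id
    have h2 := h1.indepFun_finset (Finset.range j) {j} (by simp) fun k => measurable_pi_apply k
    exact h2.comp (φ := id) (ψ := fun r : ({j} : Finset ℕ) → Γ => r ⟨j, by simp⟩)
      measurable_id (measurable_pi_apply _)
  -- Splitting by the value g of the fresh letter makes each summand a function of the past times an
  -- indicator of that letter, so independence applies.
  let Y : Γ → (Finset.range j → Γ) → ℝ := fun g r =>
    D (extendWord r i) ((randomComp (extendWord r) i : CircleHomeo) x) *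
      D g ((randomComp (extendWord r) j : CircleHomeo) x)
  let Z : Γ → Γ → ℝ := fun g => Set.indicator {g} 1
  have hZm : ∀ g, Measurable (Z g) := fun g => measurable_of_countable _
  have hYm : ∀ g, Measurable (Y g) := fun g => measurable_of_countable _
  have hC0 : 0 ≤ C := (abs_nonneg _).trans (hC 1 x)
  have hYb : ∀ g r, ‖Y g r‖ ≤ C * C := fun g r => by
    rw [norm_mul]
    exact mul_le_mul (hC _ _) (hC _ _) (abs_nonneg _) hC0
  have hZb : ∀ g h, ‖Z g h‖ ≤ 1 := fun g h => by
    simp only [Z, Set.indicator]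
    split_ifs <;> simp
  have hYint : ∀ g, Integrable (fun ω => Y g (R ω)) P := fun g =>
    Integrable.of_bound ((hYm g).comp hRm).aestronglyMeasurable (C * C)
      (Eventually.of_forall fun ω => hYb g _)
  have hYZint : ∀ g, Integrable (fun ω => Y g (R ω) * Z g (ω j)) P := fun g =>
    Integrable.of_bound (((hYm g).comp hRm).mul
      ((hZm g).comp (measurable_pi_apply j))).aestronglyMeasurable (C * C * 1)
      (Eventually.of_forall fun ω => by
        rw [norm_mul]
        exact mul_le_mul (hYb g _) (hZb g _) (norm_nonneg _) (by positivity))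
  have hpt : ∀ ω : ℕ → Γ, D (ω i) ((randomComp ω i : CircleHomeo) x) *
      D (ω j) ((randomComp ω j : CircleHomeo) x) = ∑ g ∈ S, Y g (R ω) * Z g (ω j) := by
    intro ω
    have h1 : ∀ g, Y g (R ω) = D (ω i) ((randomComp ω i : CircleHomeo) x) *
        D g ((randomComp ω j : CircleHomeo) x) := fun g => by
      have e1 : extendWord (R ω) i = ω i := dif_pos (Finset.mem_range.2 hij)
      have e2 : randomComp (extendWord (R ω)) i = randomComp ω i :=
        randomComp_extendWord ω hij.le
      have e3 : randomComp (extendWord (R ω)) j = randomComp ω j :=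
        randomComp_extendWord ω le_rfl
      simp only [Y, e1, e2, e3]
    have h2 : ∀ g, Z g (ω j) = if ω j = g then 1 else 0 := fun g => by
      simp only [Z, Set.indicator, Set.mem_singleton_iff, Pi.one_apply]
    simp only [h1, h2, mul_ite, mul_one, mul_zero]
    rw [Finset.sum_ite_eq]
    split_ifs with h
    · rfl
    · rw [hDS _ h]; simp
  simp only [hpt]
  rw [integral_finsetSum _ fun g _ => hYZint g]
  have hterm : ∀ g ∈ S, ∫ ω, Y g (R ω) * Z g (ω j) ∂P = ∫ ω, (μ g).toReal * Y g (R ω) ∂P := by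
    intro g _
    have h1 := (hind.comp (hYm g) (hZm g)).integral_fun_mul_eq_mul_integral
      ((hYm g).comp hRm).aestronglyMeasurable
      ((hZm g).comp (measurable_pi_apply j)).aestronglyMeasurable
    simp only [Function.comp_apply] at h1
    have h2 : ∫ ω, Z g (ω j) ∂P = (μ g).toReal := by
      have hmp := measurePreserving_eval_infinitePi (fun _ : ℕ => μ.toMeasure) j
      rw [← integral_map (φ := fun ω : ℕ → Γ => ω j) (measurable_pi_apply j).aemeasurable
        (hZm g).aestronglyMeasurable]
      have h3 : Measure.map (fun ω : ℕ → Γ => ω j) P = μ.toMeasure := hmp.map_eq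
      rw [h3, integral_indicator_one (MeasurableSet.of_discrete), measureReal_def,
        μ.toMeasure_apply_singleton g MeasurableSet.of_discrete]
    rw [h1, h2, integral_const_mul, mul_comm]
  rw [Finset.sum_congr rfl hterm, ← integral_finsetSum _ fun g _ => (hYint g).const_mul _]
  have hzero : ∀ r : Finset.range j → Γ, ∑ g ∈ S, (μ g).toReal * Y g r = 0 := fun r => by
    simp only [Y, mul_left_comm _ (D (extendWord r i) _)]
    rw [← Finset.mul_sum, hD0, mul_zero]
  simp only [hzero, integral_zero]

/-- The averages of a centered observable along the random walk converge to zero. -/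
theorem ae_tendsto_average_centered (μ : PMF Γ) (ν : Measure UnitAddCircle)
    [IsProbabilityMeasure ν] {S : Finset Γ}
    {D : Γ → C(UnitAddCircle, ℝ)} (hDS : ∀ g ∉ S, D g = 0)
    (hD0 : ∀ x, ∑ g ∈ S, (μ g).toReal * D g x = 0) :
    ∀ᵐ p ∂((Measure.infinitePi fun _ : ℕ => μ.toMeasure).prod ν),
      Tendsto (fun n : ℕ => (∑ i ∈ Finset.range n,
        D (p.1 i) ((randomComp p.1 i : CircleHomeo) p.2)) / (n : ℝ)) atTop (𝓝 0) := by
  have hC : ∀ g x, |D g x| ≤ ∑ g ∈ S, ‖D g‖ := by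
    intro g x
    by_cases hg : g ∈ S
    · exact ((D g).norm_coe_le_norm x).trans
        (Finset.single_le_sum (f := fun g => ‖D g‖) (fun _ _ => norm_nonneg _) hg)
    · rw [hDS g hg]
      simpa using Finset.sum_nonneg fun g _ => norm_nonneg (D g)
  refine ae_tendsto_average_zero (measurable_randomComp_eval D) (fun i p => hC _ _) ?_
  intro i j hij
  rw [integral_prod_symm]
  · simp only [integral_randomComp_mul_eq_zero μ hDS hD0 hC _ hij, integral_zero]
  · have hC0 : 0 ≤ ∑ g ∈ S, ‖D g‖ := Finset.sum_nonneg fun _ _ => norm_nonneg _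
    exact Integrable.of_bound ((measurable_randomComp_eval D i).mul
      (measurable_randomComp_eval D j)).aestronglyMeasurable
      ((∑ g ∈ S, ‖D g‖) * (∑ g ∈ S, ‖D g‖)) (Eventually.of_forall fun p => by
        rw [norm_mul]
        exact mul_le_mul (hC _ _) (hC _ _) (abs_nonneg _) hC0)

theorem ae_forall_mem_support (μ : PMF Γ) (ν : Measure UnitAddCircle) [IsProbabilityMeasure ν] :
    ∀ᵐ p ∂((Measure.infinitePi fun _ : ℕ => μ.toMeasure).prod ν), ∀ i, p.1 i ∈ μ.support := by
  rw [ae_all_iff]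
  intro i
  have h1 : ∀ᵐ g ∂μ.toMeasure, g ∈ μ.support := by
    rw [ae_iff, show {g | ¬ g ∈ μ.support} = μ.supportᶜ from rfl,
      μ.toMeasure_apply_eq_zero_iff MeasurableSet.of_discrete]
    exact disjoint_compl_right
  exact (Measure.quasiMeasurePreserving_fst (ν := ν)).ae
    ((measurePreserving_eval_infinitePi (fun _ : ℕ => μ.toMeasure) i).quasiMeasurePreserving.ae h1)

/-- For each tolerance, the log-derivative at a step is the limit value plus a centered term, a
coboundary along the orbit and a uniformly small error. Their averages tend to 0, tend to 0, and
stay small. -/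
theorem ae_tendsto_lyapunov (hΓ : Γ ≤ circleDiffOne) (μ : PMF Γ) {S : Finset Γ}
    (hS : (S : Set Γ) = μ.support) (hsum : ∑ g ∈ S, (μ g).toReal = 1)
    (ν : Measure UnitAddCircle) [IsProbabilityMeasure ν]
    (huniq : ∀ ν' : Measure UnitAddCircle, IsProbabilityMeasure ν' →
      (∀ ψ : C(UnitAddCircle, ℝ),
        ∫ x, markovOp S (fun g => (μ g).toReal) circleAct ψ x ∂ν' = ∫ x, ψ x ∂ν') → ν' = ν) :
    HasLyapunovExponent μ ν (∫ x, meanLogDeriv hΓ S (fun g => (μ g).toReal) x ∂ν) := by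
  classical
  set w : Γ → ℝ := fun g => (μ g).toReal with hw
  set P := markovOp S w (circleAct (Γ := Γ)) with hP
  set Φ := meanLogDeriv hΓ S w with hΦ
  set l := ∫ x, Φ x ∂ν with hl
  have key : ∀ k : ℕ, ∀ᵐ p ∂((Measure.infinitePi fun _ : ℕ => μ.toMeasure).prod ν),
      ∀ᶠ n : ℕ in atTop,
        |Real.log (circleDeriv (randomComp p.1 n : CircleHomeo) p.2) / (n : ℝ) - l| ≤
          3 * (1 / ((k : ℝ) + 1)) := by
    intro k
    set ε : ℝ := 1 / ((k : ℝ) + 1) with hε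
    have hεpos : 0 < ε := by positivity
    obtain ⟨N, hN0, hN⟩ := exists_cesaroOp_near (h := circleAct (Γ := Γ))
      (fun g _ => ENNReal.toReal_nonneg) hsum ν huniq Φ hεpos
    obtain ⟨f, hf⟩ := exists_sub_cesaroOp_eq P hN0 Φ
    -- Both log g' and f ∘ g are centered by their means over g, namely Φ and P f. Including f ∘ g -
    -- P f turns f - P f, evaluated along the orbit, into a telescoping difference.
    let D : Γ → C(UnitAddCircle, ℝ) := fun g =>
      if g ∈ S then logCircleDeriv hΓ g - Φ + f.comp (circleAct g) - P f else 0
    have hDS : ∀ g ∉ S, D g = 0 := fun g hg => if_neg hg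
    have hDmem : ∀ g ∈ S, ∀ x, D g x =
        logCircleDeriv hΓ g x - Φ x + f ((g : CircleHomeo) x) - P f x := fun g hg x => by
      simp only [D, if_pos hg]
      rfl
    have hD0 : ∀ x, ∑ g ∈ S, (μ g).toReal * D g x = 0 := fun x => by
      rw [Finset.sum_congr rfl fun g hg => by rw [hDmem g hg x]]
      simp only [mul_sub, mul_add, Finset.sum_sub_distrib, Finset.sum_add_distrib,
        ← Finset.sum_mul]
      rw [show ∑ g ∈ S, (μ g).toReal = 1 from hsum, one_mul, one_mul, hΦ, meanLogDeriv_apply, hP,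
        markovOp_apply]
      change _ - _ + ∑ g ∈ S, (μ g).toReal * f ((g : CircleHomeo) x) -
        ∑ g ∈ S, (μ g).toReal * f ((g : CircleHomeo) x) = 0
      ring
    filter_upwards [ae_tendsto_average_centered μ ν hDS hD0, ae_forall_mem_support μ ν]
      with p hp hsupp
    have hfε : ∀ᶠ n : ℕ in atTop, 2 * ‖f‖ / (n : ℝ) < ε :=
      (tendsto_const_div_atTop_nhds_zero_nat (2 * ‖f‖)).eventually_lt_const hεpos
    have hDε : ∀ᶠ n : ℕ in atTop, |(∑ i ∈ Finset.range n,
        D (p.1 i) ((randomComp p.1 i : CircleHomeo) p.2)) / (n : ℝ)| < ε := by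
      have := hp.abs
      rw [abs_zero] at this
      exact this.eventually_lt_const hεpos
    filter_upwards [hfε, hDε, eventually_ge_atTop 1] with n h1 h2 hn
    have hn0 : (0 : ℝ) < n := by exact_mod_cast hn
    let y : ℕ → UnitAddCircle := fun i => (randomComp p.1 i : CircleHomeo) p.2
    have hy : ∀ i, (p.1 i : CircleHomeo) (y i) = y (i + 1) := fun i => rfl
    have hterm : ∀ i, logCircleDeriv hΓ (p.1 i) (y i) =
        D (p.1 i) (y i) + (f (y i) - f (y (i + 1))) + (cesaroOp P N Φ (y i) - l) + l := by
      intro i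
      have hi : p.1 i ∈ S := by
        rw [← Finset.mem_coe, hS]; exact hsupp i
      have h3 := congrArg (fun φ : C(UnitAddCircle, ℝ) => φ (y i)) hf
      simp only [ContinuousMap.sub_apply] at h3
      rw [hDmem _ hi, hy]
      linarith
    have hsumlog : Real.log (circleDeriv (randomComp p.1 n : CircleHomeo) p.2) =
        (∑ i ∈ Finset.range n, D (p.1 i) (y i)) + (f (y 0) - f (y n))
          + (∑ i ∈ Finset.range n, (cesaroOp P N Φ (y i) - l)) + n * l := by
      rw [log_circleDeriv_randomComp hΓ, Finset.sum_congr rfl fun i _ => hterm i]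
      simp only [Finset.sum_add_distrib, Finset.sum_const, Finset.card_range, nsmul_eq_mul]
      rw [Finset.sum_range_sub' (fun i => f (y i))]
    have hA : |f (y 0) - f (y n)| ≤ 2 * ‖f‖ := by
      have a1 := f.norm_coe_le_norm (y 0)
      have a2 := f.norm_coe_le_norm (y n)
      rw [Real.norm_eq_abs] at a1 a2
      have := abs_sub (f (y 0)) (f (y n))
      linarith
    have hB : |∑ i ∈ Finset.range n, (cesaroOp P N Φ (y i) - l)| ≤ n * ε := by
      refine (Finset.abs_sum_le_sum_abs _ _).trans ?_
      refine (Finset.sum_le_sum fun i _ => hN (y i)).trans ?_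
      simp
    have heq : Real.log (circleDeriv (randomComp p.1 n : CircleHomeo) p.2) / (n : ℝ) - l =
        (∑ i ∈ Finset.range n, D (p.1 i) (y i)) / n + (f (y 0) - f (y n)) / n
          + (∑ i ∈ Finset.range n, (cesaroOp P N Φ (y i) - l)) / n := by
      rw [hsumlog]
      field_simp
      ring
    rw [heq]
    have hA' : |(f (y 0) - f (y n)) / n| ≤ 2 * ‖f‖ / n := by
      rw [abs_div, Nat.abs_cast]; gcongr
    have hB' : |(∑ i ∈ Finset.range n, (cesaroOp P N Φ (y i) - l)) / n| ≤ ε := by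
      rw [abs_div, Nat.abs_cast, div_le_iff₀ hn0, mul_comm]; exact hB
    have h5 := abs_add_three ((∑ i ∈ Finset.range n, D (p.1 i) (y i)) / n)
      ((f (y 0) - f (y n)) / n) ((∑ i ∈ Finset.range n, (cesaroOp P N Φ (y i) - l)) / n)
    have h2' : |(∑ i ∈ Finset.range n, D (p.1 i) (y i)) / n| < ε := h2
    linarith
  unfold HasLyapunovExponent
  -- The exceptional null set depends on the tolerance, so only the countable family 1 / (k + 1) is
  -- used.
  filter_upwards [ae_all_iff.2 key] with p hp
  rw [Metric.tendsto_atTop']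
  intro δ hδ
  obtain ⟨k, hk⟩ := exists_nat_one_div_lt (show 0 < δ / 3 by positivity)
  obtain ⟨n₀, hn₀⟩ := eventually_atTop.1 (hp k)
  refine ⟨n₀, fun n hn => ?_⟩
  rw [Real.dist_eq]
  linarith [hn₀ n hn.le]

end RandomWalk

/-! ### The main theorem -/

theorem PMF.integral_toMeasure_eq_sum {α : Type*} [MeasurableSpace α] [DiscreteMeasurableSpace α]
    (μ : PMF α) {S : Finset α} (hS : (S : Set α) = μ.support) (φ : α → ℝ) :
    ∫ a, φ a ∂μ.toMeasure = ∑ a ∈ S, (μ a).toReal * φ a := by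
  rw [← μ.restrict_toMeasure_support, ← hS, setIntegral_finset]
  · refine Finset.sum_congr rfl fun a _ => ?_
    rw [measureReal_def, μ.toMeasure_apply_singleton a MeasurableSet.of_discrete, smul_eq_mul]
  · exact IntegrableOn.of_finite S.finite_toSet

/-- A symmetric, finitely supported, non-degenerate random walk on circle diffeomorphisms without
invariant measure has a unique stationary measure, and its Lyapunov exponent is negative. -/
theorem mainTheorem8 (Γ : Subgroup CircleHomeo) (hΓ : Γ ≤ circleDiffOne)
    (μ : PMF Γ) (hfin : μ.support.Finite) (hnondeg : IsNondegenerateLaw μ)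
    (hsymm : IsSymmetricLaw μ)
    (hinv : ¬ ∃ ν : Measure UnitAddCircle, IsProbabilityMeasure ν ∧ PreservesMeasure Γ ν) :
    ∃ ν : Measure UnitAddCircle, (IsProbabilityMeasure ν ∧ IsStationaryMeasure μ ν) ∧
      (∀ ν' : Measure UnitAddCircle, IsProbabilityMeasure ν' → IsStationaryMeasure μ ν' → ν' = ν) ∧
      HasLyapunovExponent μ ν (lyapunovExponent μ ν) ∧ lyapunovExponent μ ν < 0 := by
  have hcount : Countable Γ := countable_of_closure_eq_top hfin.countable hnondeg
  set S : Finset Γ := hfin.toFinset with hSdef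
  have hS : (S : Set Γ) = μ.support := hfin.coe_toFinset
  set w : Γ → ℝ := fun g => (μ g).toReal with hw
  have hmem : ∀ g, g ∈ S ↔ μ g ≠ 0 := fun g => by
    rw [← Finset.mem_coe, hS, PMF.mem_support_iff]
  have hsum : ∑ g ∈ S, w g = 1 := by
    have h := μ.integral_toMeasure_eq_sum hS fun _ => 1
    simpa using h.symm
  have hweight : IsSymmetricWeight S w :=
    { pos := fun g hg => ENNReal.toReal_pos ((hmem g).1 hg) (μ.apply_ne_top g)
      sum_eq := hsum
      inv_mem := fun g hg => by rw [hmem, hsymm]; exact (hmem g).1 hg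
      inv_eq := fun g _ => by simp only [hw, hsymm g]
      closure_eq := by rw [hS]; exact hnondeg }
  have hstat : ∀ (ν : Measure UnitAddCircle) [IsProbabilityMeasure ν], IsStationaryMeasure μ ν ↔
      ∀ ψ : C(UnitAddCircle, ℝ), ∫ x, markovOp S w circleAct ψ x ∂ν = ∫ x, ψ x ∂ν := by
    intro ν _
    unfold IsStationaryMeasure
    refine forall_congr' fun ψ => ?_
    rw [integral_markovOp, μ.integral_toMeasure_eq_sum hS, eq_comm]
    rfl
  obtain ⟨ν, hν, hst, hneg⟩ := exists_stationary_integral_meanLogDeriv_neg hΓ hweight.pos hsum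
    hweight.closure_eq hinv
  have huniq : ∀ ν' : Measure UnitAddCircle, IsProbabilityMeasure ν' →
      (∀ ψ : C(UnitAddCircle, ℝ), ∫ x, markovOp S w circleAct ψ x ∂ν' = ∫ x, ψ x ∂ν') →
      ν' = ν := fun ν' _ h => stationary_unique hΓ hweight hinv h hst
  have hlyap : lyapunovExponent μ ν = ∫ x, meanLogDeriv hΓ S w x ∂ν := by
    unfold lyapunovExponent
    rw [μ.integral_toMeasure_eq_sum hS]
    simp only [meanLogDeriv_apply]
    rw [integral_finsetSum]
    · simp only [integral_const_mul]
      rfl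
    · exact fun g _ => (continuous_const.mul (logCircleDeriv hΓ g).continuous).integrable_circle _
  refine ⟨ν, ⟨hν, (hstat ν).2 hst⟩, fun ν' hν' h => huniq ν' hν' ((hstat ν').1 h), ?_, ?_⟩
  · rw [hlyap]
    exact ae_tendsto_lyapunov hΓ μ hS hsum ν huniq
  · rw [hlyap]
    exact hneg
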